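/- Let $n\ge 3$, let $\mathcal G=(\mathcal V,\mathcal E)$ be an undirected simple graph with $\mathcal V=\{1,\dots,n\}$ and neighbour sets $\mathcal N_i$, and let $p=(p_1,\dots,p_n)$ be pairwise distinct points of $\mathbb R^2$. Write $b_{ij}=(p_j-p_i)/\|p_j-p_i\|$, let $\mathscr R(\theta)$ be the rotation matrix of angle $\theta$, and put $P(b)=I_2-bb^\top$ for $b\in\mathbb R^2$ (not necessarily of norm $1$). Let $\mathcal T_{\mathcal G}=\{(i,j,k): i<k,\ (j,i),(j,k)\in\mathcal E\}$, and let $\alpha_{ijk}\in[0,2\pi)$ be the counter-clockwise angle from $b_{ji}$ to $b_{jk}$. The framework $(\mathcal G,p)$ is infinitesimally signed angle rigid (ISAR) if every $v\in(\mathbb R^2)^n$ satisfying $$\frac{b_{ji}^\top\mathscr R(\frac\pi2)}{\|p_i-p_j\|}(v_i-v_j)-\frac{b_{jk}^\top\mathscr R(\frac\pi2)}{\|p_k-p_j\|}(v_k-v_j)=0\qquad\text{for all }(i,j,k)\in\mathcal T_{\mathcal G}$$ lies in the span of $p$, of $(\mathscr R(\frac\pi2)p_i)_{i}$ and of the constant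 vectors $(x,\dots,x)$, $x\in\mathbb R^2$. The graph $\mathcal G$ is a Laman graph if $|\mathcal E|=2n-3$ and every subgraph with $v\ge2$ vertices has at most $2v-3$ edges. Let $\mathcal A\subseteq\mathcal V$ be a set of anchors and $\mathcal F=\mathcal V\setminus\mathcal A$ the set of followers. Assume that (i) $(\mathcal G,p)$ is ISAR and $\mathcal G$ is a Laman graph; (ii) $|\mathcal A|\ge2$; (iii) some two anchors are adjacent in $\mathcal G$. Let $\bar{\mathcal T}\subseteq\mathcal T_{\mathcal G}$ be obtained as follows: choose a spanning subgraph $\mathcal L$ of $\mathcal G$ that is a Laman graph with $(\mathcal L,p)$ ISAR; form the graph whose vertices are the edges of $\mathcal L$ and in which $\{j,i\}$ and $\{j,k\}$ are adjacent for each $(i,j,k)\in\mathcal T_{\mathcal L}$; choose a spanning tree of this graph (for example by breadth first search); let $\bar{\mathcal T}$ consist of the triples $(i,j,k)$, $i<k$, for which $\{j,i\}$ and $\{j,k\}$ are joined by an edge of the tree. Consider estimates $\hat p_i(t)\in\mathbb R^2$ of $p_i$ for $i\in\mathcal V$, and estimates $\hat b_{ij}(t)\in\mathbb R^2$ of $b_{ij}$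 for $i\in\mathcal V$, $j\in\mathcal N_i$, such that for all $t\ge0$: $\hat p_i(t)=p_i$ if $i\in\mathcal A$; $\hat b_{ij}(t)=b_{ij}$ if $i,j\in\mathcal A$ and $(i,j)\in\mathcal E$; for each $i\in\mathcal F$ $$\dot{\hat p}_i=-\sum_{j\in\mathcal N_i}P(\hat b_{ij})(\hat p_i-\hat p_j);$$ and for each $(i,j)\in\mathcal E$ such that $i,j$ are not both anchors $$\begin{aligned}\dot{\hat b}_{ij}=-\Big[&\sum_{k:(j,i,k)\in\bar{\mathcal T}}\big(\hat b_{ij}-\mathscr R(\alpha_{jik})^\top\hat b_{ik}\big)+\sum_{k:(k,i,j)\in\bar{\mathcal T}}\big(\hat b_{ij}-\mathscr R(\alpha_{kij})\hat b_{ik}\big)\\&+\sum_{k:(i,j,k)\in\bar{\mathcal T}}\big(\hat b_{ij}+\mathscr R(\alpha_{ijk})^\top\hat b_{jk}\big)+\sum_{k:(k,j,i)\in\bar{\mathcal T}}\big(\hat b_{ij}+\mathscr R(\alpha_{kji})\hat b_{jk}\big)\Big].\end{aligned}$$ Then for arbitrary initial values $\hat p_i(0)$ ($i\in\mathcal F$)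 and $\hat b_{ij}(0)$ ($(i,j)\in\mathcal E$, not both anchors) this system has a solution on $[0,\infty)$, and every follower's estimate converges exponentially to its true position: there is $\lambda>0$, independent of the solution, such that for every solution there is a constant $C$ with $$\|\hat p_i(t)-p_i\|\le C e^{-\lambda t}\qquad\text{for all } i\in\mathcal F,\ t\ge0 .$$ -/

import Mathlib

open scoped Matrix RealInnerProductSpace

noncomputable section

namespace SignedAngle

/-- The Euclidean plane. -/
abbrev Plane : Type := EuclideanSpace ℝ (Fin 2)

/-- The product of a `2 × 2` matrix and a vector of the plane. -/
def act (M : Matrix (Fin 2) (Fin 2) ℝ) (x : Plane) : Plane :=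
  WithLp.toLp 2 (M *ᵥ x.ofLp)

/-- The rotation matrix of (counter-clockwise) angle `θ`. -/
def rot (θ : ℝ) : Matrix (Fin 2) (Fin 2) ℝ :=
  !![Real.cos θ, -Real.sin θ; Real.sin θ, Real.cos θ]

/-- `P(b) = I - b bᵀ`, for an arbitrary vector `b` (an orthogonal projection if `‖b‖ = 1`). -/
def projMatrix (b : Plane) : Matrix (Fin 2) (Fin 2) ℝ :=
  1 - Matrix.vecMulVec b.ofLp b.ofLp

variable {n : ℕ}

/-- The bearing `b_{ij} = (p_j - p_i) / ‖p_j - p_i‖` from `p_i` to `p_j`. -/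
def bearing (p : Fin n → Plane) (i j : Fin n) : Plane :=
  ‖p j - p i‖⁻¹ • (p j - p i)

open Classical in
/-- The signed angle `α_{ijk} ∈ [0, 2π)` from `b_{ji}` to `b_{jk}`, counter-clockwise. -/
def signedAngle (p : Fin n → Plane) (i j k : Fin n) : ℝ :=
  if 0 ≤ ⟪bearing p j k, act (rot (Real.pi / 2)) (bearing p j i)⟫ then
    Real.arccos ⟪bearing p j k, bearing p j i⟫
  else
    2 * Real.pi - Real.arccos ⟪bearing p j k, bearing p j i⟫

/-- The set of all triples `(i, j, k)` with `i < k` and `(j, i)`, `(j, k)` edges; it indexes the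
signed angles of a framework on `G`. Its subsets are the angle index sets of `G`. -/
def angleTriples (G : SimpleGraph (Fin n)) : Set (Fin n × Fin n × Fin n) :=
  {t | t.1 < t.2.2 ∧ G.Adj t.2.1 t.1 ∧ G.Adj t.2.1 t.2.2}

/-- The row of the signed angle rigidity matrix at `p` with index `(i, j, k)`, applied to `v`:
`(b_{ji}ᵀ R(π/2) / ‖p_i - p_j‖) (v_i - v_j) - (b_{jk}ᵀ R(π/2) / ‖p_k - p_j‖) (v_k - v_j)`.
It is the rate of change of the signed angle `α_{ijk}` (modulo `2π`) when the points
move with velocities `v`. -/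
def signedAngleRigidityRow (p v : Fin n → Plane) (i j k : Fin n) : ℝ :=
  ⟪bearing p j i, act (rot (Real.pi / 2)) (v i - v j)⟫ / ‖p i - p j‖
    - ⟪bearing p j k, act (rot (Real.pi / 2)) (v k - v j)⟫ / ‖p k - p j‖

/-- `v` is an infinitesimal signed angle motion of `(G, p)`: it lies in the null space of the
signed angle rigidity matrix formed with all signed angles of the framework. -/
def IsInfinitesimalSignedAngleMotion (G : SimpleGraph (Fin n)) (p v : Fin n → Plane) : Prop :=
  ∀ i j k : Fin n, (i, j, k) ∈ angleTriples G → signedAngleRigidityRow p v i j k = 0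

/-- The trivial motions: spanned by uniform scalings, uniform rotations and translations. -/
def trivialMotions (p : Fin n → Plane) : Submodule ℝ (Fin n → Plane) :=
  Submodule.span ℝ {p}
    ⊔ Submodule.span ℝ {fun i => act (rot (Real.pi / 2)) (p i)}
    ⊔ Submodule.span ℝ {fun _ => !₂[1, 0], fun _ => !₂[0, 1]}

/-- `(G, p)` is infinitesimally signed angle rigid (ISAR): the points of the framework are
pairwise distinct and all its infinitesimal signed angle motions are trivial. -/
structure IsISAR (G : SimpleGraph (Fin n)) (p : Fin n → Plane) : Prop where
  injective : Function.Injective p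
  trivial_of_motion : ∀ v : Fin n → Plane,
    IsInfinitesimalSignedAngleMotion G p v → v ∈ trivialMotions p

/-- Laman graphs: `n ≥ 3` vertices, `2n - 3` edges, and every subgraph with `v ≥ 2` vertices and
`e` edges satisfies `e ≤ 2v - 3`. -/
structure IsLaman (G : SimpleGraph (Fin n)) : Prop where
  three_le : 3 ≤ n
  card_edges : G.edgeSet.ncard = 2 * n - 3
  card_edges_le : ∀ H : G.Subgraph, 2 ≤ H.verts.ncard →
    H.edgeSet.ncard ≤ 2 * H.verts.ncard - 3

/-- The angle index graph of an angle index set `T`: its vertices are the (undirected) edges of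
`G`, and each `(i, j, k) ∈ T` joins the edges `{j, i}` and `{j, k}`. -/
def angleIndexGraph (G : SimpleGraph (Fin n)) (T : Set (Fin n × Fin n × Fin n)) :
    SimpleGraph G.edgeSet :=
  SimpleGraph.fromRel fun a b =>
    ∃ i j k : Fin n, (i, j, k) ∈ T ∧ a.1 = s(j, i) ∧ b.1 = s(j, k)

/-- `T` is a possible output of the following algorithm with input the ISAR framework `(G, p)`:
choose a spanning subgraph `L` of `G` that is a Laman graph and for which `(L, p)` is ISAR; choose
a spanning tree of the angle index graph formed with all angle triples of `L`; for each
edge `{j, i} -- {j, k}` of the tree, where `i < k`, put `(i, j, k)` into `T`.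
Every spanning tree is admitted, in particular those found by breadth first search. -/
def IsTreeAngleIndexSet (G : SimpleGraph (Fin n)) (p : Fin n → Plane)
    (T : Finset (Fin n × Fin n × Fin n)) : Prop :=
  ∃ L : SimpleGraph (Fin n), L ≤ G ∧ IsLaman L ∧ IsISAR L p ∧
    ∃ tree : SimpleGraph L.edgeSet,
      tree ≤ angleIndexGraph L (angleTriples L) ∧ tree.IsTree ∧
      ∀ i j k : Fin n, (i, j, k) ∈ T ↔
        i < k ∧ ∃ (hi : s(j, i) ∈ L.edgeSet) (hk : s(j, k) ∈ L.edgeSet),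
          tree.Adj ⟨s(j, i), hi⟩ ⟨s(j, k), hk⟩

/-- The standing assumption on the sensor network with anchor set `A`: an ISAR Laman framework,
at least two anchors, and two anchors that are joined by an edge. -/
structure IsAdmissibleNetwork (G : SimpleGraph (Fin n)) (p : Fin n → Plane)
    (A : Finset (Fin n)) : Prop where
  isISAR : IsISAR G p
  isLaman : IsLaman G
  two_le_card : 2 ≤ A.card
  exists_adj : ∃ i ∈ A, ∃ j ∈ A, G.Adj i j

open Classical in
/-- Right-hand side of the position estimator of vertex `i`, for position estimates `q` and bearing
estimates `b` (where `b i j` is the estimate of `b_{ij}`). -/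
def positionField (G : SimpleGraph (Fin n)) (q : Fin n → Plane) (b : Fin n → Fin n → Plane)
    (i : Fin n) : Plane :=
  -∑ j with G.Adj i j, act (projMatrix (b i j)) (q i - q j)

/-- Right-hand side of the estimator of the bearing `b_{ij}`, for bearing estimates `b`, with
the signed angles of `p` that are indexed by `T`. -/
def bearingField (p : Fin n → Plane) (T : Finset (Fin n × Fin n × Fin n))
    (b : Fin n → Fin n → Plane) (i j : Fin n) : Plane :=
  -((∑ k with (j, i, k) ∈ T, (b i j - act (rot (signedAngle p j i k))ᵀ (b i k)))
    + (∑ k with (k, i, j) ∈ T, (b i j - act (rot (signedAngle p k i j)) (b i k)))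
    + (∑ k with (i, j, k) ∈ T, (b i j + act (rot (signedAngle p i j k))ᵀ (b j k)))
    + (∑ k with (k, j, i) ∈ T, (b i j + act (rot (signedAngle p k j i)) (b j k))))

/-- `(q, b)` is a trajectory of the localization protocol on `[0, ∞)`: `q t i` is the estimate of
`p i` and, for each edge `(i, j)`, `b t i j` is the estimate of the bearing `b_{ij}`, at time `t`.
Anchors know their positions and the bearings between adjacent anchors; all other estimates
obey the differential equations (at time `0` with the right derivative). The values `b t i j`
for non-adjacent `i`, `j` are irrelevant. -/
structure IsTrajectory (G : SimpleGraph (Fin n)) (p : Fin n → Plane) (A : Finset (Fin n))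
    (T : Finset (Fin n × Fin n × Fin n))
    (q : ℝ → Fin n → Plane) (b : ℝ → Fin n → Fin n → Plane) : Prop where
  anchor_position : ∀ t : ℝ, 0 ≤ t → ∀ i ∈ A, q t i = p i
  anchor_bearing : ∀ t : ℝ, 0 ≤ t → ∀ i ∈ A, ∀ j ∈ A, G.Adj i j → b t i j = bearing p i j
  position_ode : ∀ t : ℝ, 0 ≤ t → ∀ i ∉ A,
    HasDerivWithinAt (fun s => q s i) (positionField G (q t) (b t) i) (Set.Ici 0) t
  bearing_ode : ∀ t : ℝ, 0 ≤ t → ∀ i j : Fin n, G.Adj i j → ¬ (i ∈ A ∧ j ∈ A) →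
    HasDerivWithinAt (fun s => b s i j) (bearingField p T (b t) i j) (Set.Ici 0) t

end SignedAngle

end

/-! The system is a cascade: the bearing estimator does not involve the positions, and it drives the
position estimator.

Bearings: rotating by the true signed angles fixes the true bearings, so the errors obey a linear
leader-follower consensus equation on directed edges with isometric couplings. A Laman graph has no
proper spanning Laman subgraph, so the spanning tree reaches every edge of `G`. Edges between two
anchors have zero error, and every other edge is coupled to one that is closer in the tree to a
fixed anchor edge. Weights depending on this distance make the system strictly diagonally dominant,
and a weighted maximum norm decays exponentially (`exists_weights`, `exists_consensus_rate`).

Positions: let `V` be the sum of squared position errors. With the true bearings, `V` decreases at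
the rate of the bearing energy. If that energy vanishes, the error is an infinitesimal signed angle
motion, hence trivial by ISAR, and it is zero because it vanishes at two anchors. In finite
dimension this yields coercivity (`exists_bearing_energy_coercive`). The bearing errors add only a
term of order `exp (-μ t) (V + 1)`, which `exists_le_exp_of_deriv_le` absorbs.

Existence: the bearing equation is linear. Its solutions are bounded by the convergence just
described, so the position equation is linear with bounded continuous coefficients, and a global
Picard argument applies to each. -/

noncomputable section

namespace SignedAngle

open Set Filter Topology

/-! ### Ordinary differential equations: global existence, comparison, consensus -/

section Analysis

/-- The integral of a function of exponential growth. -/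
theorem norm_integral_le_of_norm_le_exp {E : Type*} [NormedAddCommGroup E] [NormedSpace ℝ E]
    {g : ℝ → E} {c κ : ℝ} (hκ : 0 < κ) (hc : 0 ≤ c)
    (hg : ∀ s, 0 ≤ s → ‖g s‖ ≤ c * Real.exp (κ * s)) {t : ℝ} (ht : 0 ≤ t) :
    ‖∫ s in (0 : ℝ)..t, g s‖ ≤ c / κ * Real.exp (κ * t) := by
  have hint : ∫ s in (0 : ℝ)..t, c * Real.exp (κ * s)
      = c / κ * Real.exp (κ * t) - c / κ * Real.exp (κ * 0) := by
    refine intervalIntegral.integral_eq_sub_of_hasDerivAt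
      (f := fun s => c / κ * Real.exp (κ * s)) (fun s _ => ?_) ?_
    · have h := (((hasDerivAt_id s).const_mul κ).exp).const_mul (c / κ)
      convert! h using 1
      simp only [id]
      field_simp
    · exact Continuous.intervalIntegrable (by fun_prop) _ _
  calc ‖∫ s in (0 : ℝ)..t, g s‖ ≤ ∫ s in (0 : ℝ)..t, c * Real.exp (κ * s) := by
        refine intervalIntegral.norm_integral_le_of_norm_le ht ?_ ?_
        · exact Eventually.of_forall fun s hs => hg s hs.1.le
        · exact Continuous.intervalIntegrable (by fun_prop) _ _
    _ ≤ _ := by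
        rw [hint]
        have : 0 ≤ c / κ * Real.exp (κ * 0) := by positivity
        linarith

/-- Global forward existence for a time-dependent vector field that is globally Lipschitz. -/
theorem exists_forward_solution {E : Type*} [NormedAddCommGroup E] [NormedSpace ℝ E]
    [CompleteSpace E] {f : ℝ → E → E} {K M : ℝ} (hf : Continuous (Function.uncurry f))
    (hlip : ∀ t x y, ‖f t x - f t y‖ ≤ K * ‖x - y‖) (hM : ∀ t, ‖f t 0‖ ≤ M) (x₀ : E) :
    ∃ x : ℝ → E, x 0 = x₀ ∧ Continuous x ∧
      ∀ t, 0 ≤ t → HasDerivWithinAt x (f t (x t)) (Ici 0) t := by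
  -- Integrating against `exp (κ s)` gains `1 / κ`; with Lipschitz constant at most `κ / 2` the
  -- Picard map contracts by `1 / 2`.
  obtain ⟨κ, hκ, hKκ⟩ : ∃ κ : ℝ, 0 < κ ∧ |K| ≤ κ / 2 :=
    ⟨2 * |K| + 1, by positivity, by linarith⟩
  have hM0 : 0 ≤ M := (norm_nonneg _).trans (hM 0)
  have hlip' : ∀ t x y, ‖f t x - f t y‖ ≤ κ / 2 * ‖x - y‖ := fun t x y =>
    (hlip t x y).trans (by gcongr; exact (le_abs_self K).trans hKκ)
  have hcont : ∀ y : ℝ → E, Continuous y → Continuous fun s => f s (y s) := fun y hy =>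
    hf.comp (continuous_id.prodMk hy)
  have hprim : ∀ y : ℝ → E, Continuous y → Continuous fun t => ∫ s in (0 : ℝ)..t, f s (y s) :=
    fun y hy => intervalIntegral.continuous_primitive
      (fun a b => (hcont y hy).intervalIntegrable a b) 0
  set lift : (ℝ → E) → ℝ → E := fun y s => Real.exp (κ * s) • y s with hlift
  have hliftc : ∀ y : BoundedContinuousFunction ℝ E, Continuous (lift y) := fun y => by
    have := y.continuous
    fun_prop
  -- The Picard map in the unknown `y = exp (-κ t) x`, which covers the whole half-line at once. The
  -- `max t 0` extends it by a constant to negative times.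
  set Φ : BoundedContinuousFunction ℝ E → ℝ → E := fun y t =>
    Real.exp (-(κ * max t 0)) • (x₀ + ∫ s in (0 : ℝ)..(max t 0), f s (lift y s)) with hΦ
  have hΦc : ∀ y, Continuous (Φ y) := fun y => by
    have h := (hprim _ (hliftc y)).comp (continuous_id.max continuous_const : Continuous
      fun t : ℝ => max t 0)
    have h' : Continuous fun t : ℝ => Real.exp (-(κ * max t 0)) := by fun_prop
    exact h'.smul (continuous_const.add h)
  have hscale : ∀ (t c : ℝ) (v : E), 0 ≤ t → ‖v‖ ≤ c * Real.exp (κ * t) →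
      ‖Real.exp (-(κ * t)) • v‖ ≤ c := fun t c v _ hv => by
    rw [norm_smul, Real.norm_eq_abs, Real.abs_exp]
    calc Real.exp (-(κ * t)) * ‖v‖ ≤ Real.exp (-(κ * t)) * (c * Real.exp (κ * t)) := by gcongr
      _ = c * (Real.exp (-(κ * t)) * Real.exp (κ * t)) := by ring
      _ = c := by rw [← Real.exp_add]; simp
  have hone : ∀ t : ℝ, 0 ≤ t → 1 ≤ Real.exp (κ * t) := fun t ht =>
    Real.one_le_exp (by positivity)
  have hΦb : ∀ y, ∃ C, ∀ t, ‖Φ y t‖ ≤ C := fun y => by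
    refine ⟨‖x₀‖ + (κ / 2 * ‖y‖ + M) / κ, fun t => ?_⟩
    have ht : 0 ≤ max t 0 := le_max_right _ _
    refine hscale _ _ _ ht ?_
    have h1 : ‖∫ s in (0 : ℝ)..(max t 0), f s (lift y s)‖
        ≤ (κ / 2 * ‖y‖ + M) / κ * Real.exp (κ * max t 0) := by
      refine norm_integral_le_of_norm_le_exp hκ (by positivity) (fun s hs => ?_) ht
      have h2 := hlip' s (lift y s) 0
      have h3 := norm_le_norm_add_norm_sub' (f s (lift y s)) (f s 0)
      have h4 : ‖lift y s - 0‖ ≤ Real.exp (κ * s) * ‖y‖ := by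
        rw [sub_zero, hlift]
        simp only [norm_smul, Real.norm_eq_abs, Real.abs_exp]
        gcongr
        exact y.norm_coe_le_norm s
      have h5 : κ / 2 * ‖lift y s - 0‖ ≤ κ / 2 * (Real.exp (κ * s) * ‖y‖) := by gcongr
      have h6 : M * 1 ≤ M * Real.exp (κ * s) := by gcongr; exact hone s hs
      linarith [hM s]
    have h2 : ‖x₀‖ * 1 ≤ ‖x₀‖ * Real.exp (κ * max t 0) := by gcongr; exact hone _ ht
    refine (norm_add_le _ _).trans ?_
    linarith
  choose C hC using hΦb
  let Ψ : BoundedContinuousFunction ℝ E → BoundedContinuousFunction ℝ E := fun y =>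
    BoundedContinuousFunction.ofNormedAddCommGroup (Φ y) (hΦc y) (C y) (hC y)
  have hcontr : ContractingWith (1 / 2) Ψ := by
    refine ⟨by rw [← NNReal.coe_lt_coe]; norm_num, LipschitzWith.of_dist_le_mul fun y z => ?_⟩
    rw [BoundedContinuousFunction.dist_le (by positivity)]
    intro t
    have ht : 0 ≤ max t 0 := le_max_right _ _
    rw [dist_eq_norm]
    change ‖Φ y t - Φ z t‖ ≤ _
    rw [hΦ]
    simp only [← smul_sub, add_sub_add_left_eq_sub]
    refine hscale _ _ _ ht ?_
    rw [← intervalIntegral.integral_sub ((hcont _ (hliftc y)).intervalIntegrable _ _)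
      ((hcont _ (hliftc z)).intervalIntegrable _ _)]
    have := norm_integral_le_of_norm_le_exp (g := fun s => f s (lift y s) - f s (lift z s))
      (c := κ / 2 * dist y z) hκ (by positivity) (fun s hs => ?_) ht
    · refine this.trans (le_of_eq ?_)
      push_cast
      field_simp
    · refine (hlip' _ _ _).trans ?_
      have h : ‖lift y s - lift z s‖ ≤ Real.exp (κ * s) * dist y z := by
        simp only [hlift, ← smul_sub, norm_smul, Real.norm_eq_abs, Real.abs_exp]
        gcongr
        rw [← dist_eq_norm]
        exact BoundedContinuousFunction.dist_coe_le_dist s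
      calc _ ≤ κ / 2 * (Real.exp (κ * s) * dist y z) := by gcongr
        _ = _ := by ring
  set y := ContractingWith.fixedPoint Ψ hcontr
  have hy : ∀ t, 0 ≤ t → lift y t = x₀ + ∫ s in (0 : ℝ)..t, f s (lift y s) := fun t ht => by
    have h1 : Ψ y = y := hcontr.fixedPoint_isFixedPt
    have h2 : y t = Φ y t := (DFunLike.congr_fun h1 t).symm
    simp only [hlift] at h2 ⊢
    rw [h2, hΦ]
    simp only [max_eq_left ht, smul_smul, ← Real.exp_add]
    simp [hlift]
  refine ⟨lift y, by simpa using hy 0 le_rfl, hliftc y, fun t ht => ?_⟩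
  have hd : HasDerivAt (fun t => x₀ + ∫ s in (0 : ℝ)..t, f s (lift y s)) (f t (lift y t)) t :=
    (intervalIntegral.integral_hasDerivAt_right ((hcont _ (hliftc y)).intervalIntegrable _ _)
      (hcont _ (hliftc y)).stronglyMeasurable.stronglyMeasurableAtFilter
      (hcont _ (hliftc y)).continuousAt).const_add _
  exact hd.hasDerivWithinAt.congr (fun s hs => hy s hs) (hy t ht)

/-- A scalar comparison: exponential decay is robust under exponentially small perturbations. -/
theorem exists_le_exp_of_deriv_le {V V' : ℝ → ℝ} {γ μ K : ℝ} (hγμ : γ < μ)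
    (hV0 : ∀ t, 0 ≤ t → 0 ≤ V t)
    (hV : ∀ t, 0 ≤ t → HasDerivWithinAt V (V' t) (Ici 0) t)
    (hV' : ∀ t, 0 ≤ t → V' t ≤ -γ * V t + K * Real.exp (-μ * t) * (V t + 1)) (hK : 0 ≤ K)
    (hγ : 0 ≤ γ) :
    ∃ C, ∀ t, 0 ≤ t → V t ≤ C * Real.exp (-γ * t) := by
  -- `exp a` is an integrating factor for the perturbation. Since `exp (γ t) ≥ 1`, the quantity `V
  -- exp (γ t) + 1` grows at relative rate at most `K exp (-(μ - γ) t)`, which is `-a'`; hence `W`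
  -- is nonincreasing.
  set a : ℝ → ℝ := fun t => K / (μ - γ) * Real.exp (-(μ - γ) * t) with ha
  set W : ℝ → ℝ := fun t => (V t * Real.exp (γ * t) + 1) * Real.exp (a t) with hW
  have hne : μ - γ ≠ 0 := by linarith
  have hda : ∀ t, HasDerivAt a (-(K * Real.exp (-(μ - γ) * t))) t := fun t => by
    have h := (((hasDerivAt_id t).const_mul (-(μ - γ))).exp).const_mul (K / (μ - γ))
    convert! h using 1
    simp only [id]
    field_simp
  have hde : ∀ t, HasDerivAt (fun t => Real.exp (γ * t)) (γ * Real.exp (γ * t)) t := fun t => by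
    have h := ((hasDerivAt_id t).const_mul γ).exp
    convert! h using 1
    simp only [id]
    ring
  have hdW : ∀ t, 0 ≤ t → HasDerivWithinAt W
      ((V' t * Real.exp (γ * t) + V t * (γ * Real.exp (γ * t))) * Real.exp (a t)
        + (V t * Real.exp (γ * t) + 1)
          * (Real.exp (a t) * -(K * Real.exp (-(μ - γ) * t)))) (Ici 0) t := fun t ht =>
    (((hV t ht).mul (hde t).hasDerivWithinAt).add_const 1).mul (hda t).exp.hasDerivWithinAt
  have hanti : AntitoneOn W (Ici 0) := by
    refine antitoneOn_of_deriv_nonpos (convex_Ici 0)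
      (fun t ht => (hdW t ht).continuousWithinAt) ?_ ?_
    · intro t ht
      rw [interior_Ici] at ht
      exact ((hdW t (le_of_lt ht)).hasDerivAt (Ici_mem_nhds ht)).differentiableAt
        |>.differentiableWithinAt
    · intro t ht
      rw [interior_Ici] at ht
      have ht0 : 0 ≤ t := le_of_lt ht
      rw [((hdW t ht0).hasDerivAt (Ici_mem_nhds ht)).deriv]
      have hE : Real.exp (-(μ - γ) * t) = Real.exp (-μ * t) * Real.exp (γ * t) := by
        rw [← Real.exp_add]; congr 1; ring
      have h1 : 1 ≤ Real.exp (γ * t) := Real.one_le_exp (by positivity)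
      have h2 := mul_le_mul_of_nonneg_right (hV' t ht0) (Real.exp_pos (γ * t)).le
      have h3 : 0 ≤ K * Real.exp (-μ * t) * Real.exp (γ * t)
          * (V t * (Real.exp (γ * t) - 1)) := by
        have := hV0 t ht0
        have : 0 ≤ Real.exp (γ * t) - 1 := by linarith
        positivity
      have h4 : (V' t * Real.exp (γ * t) + V t * (γ * Real.exp (γ * t)))
          - (V t * Real.exp (γ * t) + 1) * (K * Real.exp (-(μ - γ) * t)) ≤ 0 := by
        rw [hE]; linarith
      calc _ = ((V' t * Real.exp (γ * t) + V t * (γ * Real.exp (γ * t)))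
          - (V t * Real.exp (γ * t) + 1) * (K * Real.exp (-(μ - γ) * t))) * Real.exp (a t) := by
            ring
        _ ≤ 0 := mul_nonpos_of_nonpos_of_nonneg h4 (Real.exp_pos _).le
  refine ⟨W 0, fun t ht => ?_⟩
  have h1 : W t ≤ W 0 := hanti self_mem_Ici ht ht
  have hV0t := hV0 t ht
  have ha0 : 0 ≤ a t := by
    have : 0 < μ - γ := by linarith
    positivity
  have h2 : V t * Real.exp (γ * t) ≤ W t := by
    have h3 : 1 ≤ Real.exp (a t) := Real.one_le_exp ha0
    have h4 : 0 ≤ V t * Real.exp (γ * t) + 1 := by positivity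
    calc V t * Real.exp (γ * t) ≤ (V t * Real.exp (γ * t) + 1) * 1 := by linarith
      _ ≤ W t := mul_le_mul_of_nonneg_left h3 h4
  calc V t = V t * Real.exp (γ * t) * Real.exp (-γ * t) := by
        rw [mul_assoc, ← Real.exp_add]; simp
    _ ≤ W 0 * Real.exp (-γ * t) := by gcongr; exact h2.trans h1

/-- Weights certifying that a leader-follower network, every follower of which has an arc to a node
of smaller depth, is strictly diagonally dominant. -/
theorem exists_weights {X ι : Type*} [Fintype X] [Fintype ι] (S : Set X)
    (arcs : X → Finset ι) (target : X → ι → X) (d : X → ℕ)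
    (hd : ∀ x ∈ S, ∃ m ∈ arcs x, d (target x m) < d x) :
    ∃ (w : X → ℝ) (μ : ℝ), 0 < μ ∧ μ ≤ 1 ∧ (∀ x, 1 ≤ w x) ∧
      ∀ x ∈ S, μ * w x ≤ ∑ m ∈ arcs x, (w x - w (target x m)) := by
  set N : ℝ := (Fintype.card ι : ℝ) with hN
  have hN0 : 0 ≤ N := by positivity
  -- With `w = 2 - r ^ d`, the arc to smaller depth contributes at least `(N + 1) r ^ d x`. Each of
  -- the at most `N` other arcs costs at most `r ^ d x`, because all weights are below `2`.
  set r : ℝ := (N + 2)⁻¹ with hr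
  have hr0 : 0 < r := by positivity
  have hrN : r * (N + 2) = 1 := inv_mul_cancel₀ (by positivity)
  have hr1 : r ≤ 1 := by nlinarith
  set w : X → ℝ := fun x => 2 - r ^ d x with hw
  have hpos : ∀ x ∈ S, 0 < ∑ m ∈ arcs x, (w x - w (target x m)) := by
    classical
    intro x hx
    obtain ⟨m₀, hm₀, hlt⟩ := hd x hx
    have hρ : 0 < r ^ d x := by positivity
    have h1 : (N + 1) * r ^ d x ≤ w x - w (target x m₀) := by
      have h2 : r ^ (d x - 1) ≤ r ^ d (target x m₀) :=
        pow_le_pow_of_le_one hr0.le hr1 (by omega)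
      have h3 : r ^ d x = r ^ (d x - 1) * r := by
        rw [← pow_succ]; congr 1; omega
      have h4 : (N + 2) * r ^ d x = r ^ (d x - 1) := by
        rw [h3]; linear_combination r ^ (d x - 1) * hrN
      simp only [hw]
      linarith
    have h2 : ∀ m ∈ (arcs x).erase m₀, -r ^ d x ≤ w x - w (target x m) := fun m hm => by
      have : 0 < r ^ d (target x m) := by positivity
      simp only [hw]
      linarith
    have h3 := Finset.card_nsmul_le_sum _ _ _ h2
    have h4 : (((arcs x).erase m₀).card : ℝ) ≤ N := by
      rw [hN]; exact_mod_cast Finset.card_le_univ _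
    rw [← Finset.add_sum_erase _ _ hm₀]
    rw [nsmul_eq_mul] at h3
    nlinarith
  obtain ⟨ε, hε, hεx⟩ : ∃ ε : ℝ, 0 < ε ∧
      ∀ x ∈ S, ε ≤ ∑ m ∈ arcs x, (w x - w (target x m)) := by
    classical
    have hfin : (Set.toFinite S).toFinset.Nonempty ∨ S = ∅ := by
      rcases S.eq_empty_or_nonempty with h | h
      · exact Or.inr h
      · left; simpa using h
    rcases hfin with h | h
    · obtain ⟨x₀, hx₀, hmin⟩ := Finset.exists_min_image _
        (fun x => ∑ m ∈ arcs x, (w x - w (target x m))) h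
      exact ⟨_, hpos x₀ (by simpa using hx₀), fun x hx => hmin x (by simpa using hx)⟩
    · exact ⟨1, one_pos, by simp [h]⟩
  -- The bound `w ≤ 2` turns the additive margin `ε` into a multiple of `w x`.
  refine ⟨w, min (ε / 2) 1, by positivity, min_le_right _ _, fun x => ?_, fun x hx => ?_⟩
  · have : r ^ d x ≤ 1 := pow_le_one₀ hr0.le hr1
    simp only [hw]
    linarith
  · have h1 : 0 < r ^ d x := by positivity
    have h2 : w x ≤ 2 := by simp only [hw]; linarith
    have h3 : 1 ≤ w x := by
      have : r ^ d x ≤ 1 := pow_le_one₀ hr0.le hr1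
      simp only [hw]
      linarith
    calc min (ε / 2) 1 * w x ≤ ε / 2 * 2 := by gcongr; exact min_le_left _ _
      _ = ε := by ring
      _ ≤ _ := hεx x hx

/-- Exponential convergence of a leader-follower consensus protocol with isometric couplings. -/
theorem exists_consensus_rate {X ι V : Type*} [Fintype X] [Fintype ι] [NormedAddCommGroup V]
    [NormedSpace ℝ V] (S : Set X) (arcs : X → Finset ι) (target : X → ι → X)
    (M : X → ι → V → V) (hM : ∀ x m v, ‖M x m v‖ ≤ ‖v‖) (d : X → ℕ)
    (hd : ∀ x ∈ S, ∃ m ∈ arcs x, d (target x m) < d x) :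
    ∃ μ : ℝ, 0 < μ ∧ ∀ e : ℝ → X → V, (∀ t, 0 ≤ t → ∀ x ∉ S, e t x = 0) →
      (∀ t, 0 ≤ t → ∀ x ∈ S, HasDerivWithinAt (fun s => e s x)
        (-∑ m ∈ arcs x, (e t x - M x m (e t (target x m)))) (Ici 0) t) →
      ∃ C : ℝ, 0 ≤ C ∧ ∀ t, 0 ≤ t → ∀ x, ‖e t x‖ ≤ C * Real.exp (-μ * t) := by
  classical
  obtain ⟨w, μ, hμ, hμ1, hw, hdom⟩ := exists_weights S arcs target d hd
  refine ⟨μ, hμ, fun e he0 he => ?_⟩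
  have hwpos : ∀ x, 0 < w x := fun x => one_pos.trans_le (hw x)
  -- The shift by `c` makes the coefficient `c - (arcs x).card` of the diagonal term nonnegative, so
  -- the triangle inequality loses no damping; `c - μ ≥ 0` follows from `μ ≤ 1`.
  set c : ℝ := (Fintype.card ι : ℝ) + 1 with hc
  set u : ℝ → X → V := fun t x => (Real.exp (c * t) * (w x)⁻¹) • e t x with hu
  set u' : ℝ → X → V := fun t x => if x ∈ S then
    (Real.exp (c * t) * (w x)⁻¹) •
      (c • e t x - ∑ m ∈ arcs x, (e t x - M x m (e t (target x m)))) else 0 with hu'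
  have hderiv : ∀ t, 0 ≤ t → HasDerivWithinAt u (u' t) (Ici 0) t := by
    intro t ht
    rw [hasDerivWithinAt_pi]
    intro x
    by_cases hx : x ∈ S
    · have h1 : HasDerivAt (fun s => Real.exp (c * s) * (w x)⁻¹)
          (c * (Real.exp (c * t) * (w x)⁻¹)) t := by
        have h := (((hasDerivAt_id t).const_mul c).exp).mul_const (w x)⁻¹
        convert! h using 1
        simp only [id]
        ring
      convert! h1.hasDerivWithinAt.smul (he t ht x hx) using 1
      simp only [hu', if_pos hx, smul_sub, smul_neg, smul_smul]
      rw [mul_comm (Real.exp (c * t) * (w x)⁻¹) c]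
      abel
    · simp only [hu', if_neg hx]
      refine (hasDerivWithinAt_const t (Ici 0) (0 : V)).congr (fun s hs => ?_) ?_
      · simp [hu, he0 s hs x hx]
      · simp [hu, he0 t ht x hx]
  have hnorm : ∀ t x, Real.exp (c * t) * ‖e t x‖ ≤ w x * ‖u t‖ := fun t x => by
    have h1 : ‖u t x‖ ≤ ‖u t‖ := norm_le_pi_norm _ _
    have h2 : ‖u t x‖ = Real.exp (c * t) * (w x)⁻¹ * ‖e t x‖ := by
      simp only [hu, norm_smul, norm_mul, norm_inv, Real.norm_eq_abs, Real.abs_exp,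
        abs_of_pos (hwpos x)]
    calc Real.exp (c * t) * ‖e t x‖ = w x * ‖u t x‖ := by
          rw [h2]; field_simp [(hwpos x).ne']
      _ ≤ _ := by gcongr; exact (hwpos x).le
  have hbound : ∀ t, ‖u' t‖ ≤ (c - μ) * ‖u t‖ := fun t => by
    have hcμ : 0 ≤ c - μ := by
      have : (0 : ℝ) ≤ Fintype.card ι := by positivity
      linarith
    rw [pi_norm_le_iff_of_nonneg (by positivity)]
    intro x
    by_cases hx : x ∈ S
    · have hcard : ((arcs x).card : ℝ) ≤ c := by
        have : ((arcs x).card : ℝ) ≤ Fintype.card ι := by exact_mod_cast Finset.card_le_univ _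
        linarith
      have hsplit : c • e t x - ∑ m ∈ arcs x, (e t x - M x m (e t (target x m)))
          = (c - (arcs x).card) • e t x + ∑ m ∈ arcs x, M x m (e t (target x m)) := by
        rw [Finset.sum_sub_distrib, Finset.sum_const, sub_smul, Nat.cast_smul_eq_nsmul]
        abel
      have h1 : ‖(c - (arcs x).card) • e t x + ∑ m ∈ arcs x, M x m (e t (target x m))‖
          ≤ (c - (arcs x).card) * ‖e t x‖ + ∑ m ∈ arcs x, ‖e t (target x m)‖ := by
        refine (norm_add_le _ _).trans (add_le_add ?_ ?_)
        · rw [norm_smul, Real.norm_eq_abs, abs_of_nonneg (by linarith)]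
        · exact (norm_sum_le _ _).trans (Finset.sum_le_sum fun m _ => hM _ _ _)
      have h2 : Real.exp (c * t) * ((c - (arcs x).card) * ‖e t x‖
          + ∑ m ∈ arcs x, ‖e t (target x m)‖)
          ≤ ((c - (arcs x).card) * w x + ∑ m ∈ arcs x, w (target x m)) * ‖u t‖ := by
        have h3 := mul_le_mul_of_nonneg_left (hnorm t x) (sub_nonneg.2 hcard)
        have h4 : ∑ m ∈ arcs x, Real.exp (c * t) * ‖e t (target x m)‖
            ≤ ∑ m ∈ arcs x, w (target x m) * ‖u t‖ := Finset.sum_le_sum fun m _ => hnorm t _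
        rw [← Finset.mul_sum, ← Finset.sum_mul] at h4
        linarith
      have h5 : (c - (arcs x).card) * w x + ∑ m ∈ arcs x, w (target x m) ≤ (c - μ) * w x := by
        have h6 := hdom x hx
        rw [Finset.sum_sub_distrib, Finset.sum_const, nsmul_eq_mul] at h6
        linarith
      simp only [hu', if_pos hx]
      rw [hsplit, norm_smul, norm_mul, norm_inv, Real.norm_eq_abs, Real.abs_exp, Real.norm_eq_abs,
        abs_of_pos (hwpos x)]
      calc _ ≤ Real.exp (c * t) * (w x)⁻¹ * ((c - (arcs x).card) * ‖e t x‖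
            + ∑ m ∈ arcs x, ‖e t (target x m)‖) := by
            have := hwpos x
            gcongr
        _ = (w x)⁻¹ * (Real.exp (c * t) * ((c - (arcs x).card) * ‖e t x‖
            + ∑ m ∈ arcs x, ‖e t (target x m)‖)) := by ring
        _ ≤ (w x)⁻¹ * (((c - μ) * w x) * ‖u t‖) := by
            have := hwpos x
            exact mul_le_mul_of_nonneg_left
              (h2.trans (mul_le_mul_of_nonneg_right h5 (norm_nonneg _))) (by positivity)
        _ = (c - μ) * ‖u t‖ := by field_simp [(hwpos x).ne']
    · simp only [hu', if_neg hx, norm_zero]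
      positivity
  set B : ℝ := ∑ x, w x with hB
  have hwB : ∀ x, w x ≤ B := fun x =>
    Finset.single_le_sum (fun y _ => (hwpos y).le) (Finset.mem_univ x)
  have hB0 : 0 ≤ B := Finset.sum_nonneg fun y _ => (hwpos y).le
  refine ⟨B * ‖u 0‖, by positivity, fun t ht x => ?_⟩
  -- Grönwall gives growth `exp ((c - μ) t)` for `u`; undoing the factor `exp (c t)` leaves `exp (-μ
  -- t)`.
  have hg := norm_le_gronwallBound_of_norm_deriv_right_le (f := u) (f' := u') (δ := ‖u 0‖)
    (K := c - μ) (ε := 0) (a := 0) (b := t)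
    (fun s hs => (hderiv s hs.1).continuousWithinAt.mono Icc_subset_Ici_self)
    (fun s hs => (hderiv s hs.1).mono (Ici_subset_Ici.2 hs.1)) le_rfl
    (fun s _ => by simpa using hbound s) t ⟨ht, le_rfl⟩
  rw [gronwallBound_ε0, sub_zero] at hg
  calc ‖e t x‖ = Real.exp (-(c * t)) * (Real.exp (c * t) * ‖e t x‖) := by
        rw [← mul_assoc, ← Real.exp_add]; simp
    _ ≤ Real.exp (-(c * t)) * (B * (‖u 0‖ * Real.exp ((c - μ) * t))) := by
        exact mul_le_mul_of_nonneg_left ((hnorm t x).trans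
          (mul_le_mul (hwB x) hg (norm_nonneg _) hB0)) (Real.exp_pos _).le
    _ = B * ‖u 0‖ * (Real.exp (-(c * t)) * Real.exp ((c - μ) * t)) := by ring
    _ = _ := by rw [← Real.exp_add]; congr 2; ring

end Analysis

/-! ### Rotations and the matrices `P(b)` in the plane -/

section Plane

theorem inner_eq (x y : Plane) : ⟪x, y⟫ = x 0 * y 0 + x 1 * y 1 := by
  simp only [PiLp.inner_apply, Fin.sum_univ_two, RCLike.inner_apply, conj_trivial]
  ring

theorem norm_sq_eq (x : Plane) : ‖x‖ ^ 2 = x 0 ^ 2 + x 1 ^ 2 := by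
  rw [← real_inner_self_eq_norm_sq, inner_eq]; ring

theorem plane_ext {x y : Plane} (h0 : x 0 = y 0) (h1 : x 1 = y 1) : x = y := by
  ext i; fin_cases i <;> assumption

theorem act_apply_zero (M : Matrix (Fin 2) (Fin 2) ℝ) (x : Plane) :
    act M x 0 = M 0 0 * x 0 + M 0 1 * x 1 := by
  simp [act]

theorem act_apply_one (M : Matrix (Fin 2) (Fin 2) ℝ) (x : Plane) :
    act M x 1 = M 1 0 * x 0 + M 1 1 * x 1 := by
  simp [act]

theorem act_add (M : Matrix (Fin 2) (Fin 2) ℝ) (x y : Plane) :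
    act M (x + y) = act M x + act M y := by
  apply plane_ext <;> simp only [act_apply_zero, act_apply_one, PiLp.add_apply] <;> ring

theorem act_smul (M : Matrix (Fin 2) (Fin 2) ℝ) (c : ℝ) (x : Plane) :
    act M (c • x) = c • act M x := by
  apply plane_ext <;>
    simp only [act_apply_zero, act_apply_one, PiLp.smul_apply, smul_eq_mul] <;> ring

theorem act_neg (M : Matrix (Fin 2) (Fin 2) ℝ) (x : Plane) : act M (-x) = -act M x := by
  rw [← neg_one_smul ℝ x, act_smul, neg_one_smul]

theorem act_sub (M : Matrix (Fin 2) (Fin 2) ℝ) (x y : Plane) :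
    act M (x - y) = act M x - act M y := by
  rw [sub_eq_add_neg, act_add, act_neg, sub_eq_add_neg]

theorem norm_act_rot (θ : ℝ) (x : Plane) : ‖act (rot θ) x‖ = ‖x‖ := by
  rw [← sq_eq_sq₀ (norm_nonneg _) (norm_nonneg _), norm_sq_eq, norm_sq_eq, act_apply_zero,
    act_apply_one]
  simp only [rot, Matrix.of_apply, Matrix.cons_val', Matrix.cons_val_zero, Matrix.cons_val_one,
    Matrix.cons_val_fin_one]
  linear_combination (x 0 ^ 2 + x 1 ^ 2) * Real.sin_sq_add_cos_sq θ

theorem rot_transpose (θ : ℝ) : (rot θ)ᵀ = rot (-θ) := by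
  ext i j
  fin_cases i <;> fin_cases j <;> simp [rot]

theorem act_rot_transpose_act_rot (θ : ℝ) (x : Plane) : act (rot θ)ᵀ (act (rot θ) x) = x := by
  have h := Real.sin_sq_add_cos_sq θ
  apply plane_ext <;> rw [rot_transpose] <;>
    simp only [act_apply_zero, act_apply_one, rot, Matrix.of_apply, Matrix.cons_val',
      Matrix.cons_val_zero, Matrix.cons_val_one, Matrix.cons_val_fin_one, Real.cos_neg,
      Real.sin_neg]
  · linear_combination x 0 * h
  · linear_combination x 1 * h

theorem act_rot_pi_div_two_zero (x : Plane) : act (rot (Real.pi / 2)) x 0 = -x 1 := by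
  simp [act_apply_zero, rot]

theorem act_rot_pi_div_two_one (x : Plane) : act (rot (Real.pi / 2)) x 1 = x 0 := by
  simp [act_apply_one, rot]

theorem act_projMatrix (b v : Plane) : act (projMatrix b) v = v - ⟪b, v⟫ • b := by
  apply plane_ext <;>
    simp only [act_apply_zero, act_apply_one, projMatrix, inner_eq, Matrix.sub_apply,
      Matrix.vecMulVec_apply, PiLp.sub_apply, PiLp.smul_apply, smul_eq_mul] <;>
    simp <;> ring

/-- For a unit vector `b`, `P(b)` is symmetric and idempotent. -/
theorem norm_act_projMatrix_sq {b : Plane} (hb : ‖b‖ = 1) (v : Plane) :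
    ‖act (projMatrix b) v‖ ^ 2 = ⟪v, act (projMatrix b) v⟫ := by
  have h : b 0 ^ 2 + b 1 ^ 2 = 1 := by rw [← norm_sq_eq, hb]; norm_num
  rw [act_projMatrix, norm_sq_eq]
  simp only [inner_eq, PiLp.sub_apply, PiLp.smul_apply, smul_eq_mul]
  linear_combination (b 0 * v 0 + b 1 * v 1) ^ 2 * h

theorem projMatrix_neg (b : Plane) : projMatrix (-b) = projMatrix b := by
  simp [projMatrix, Matrix.vecMulVec_neg, Matrix.neg_vecMulVec]

/-- `P` is quadratic in `b`, so its increment is bilinear in `b - c` and `b`, `c`. No normalization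
is assumed, since estimated bearings need not have norm one. -/
theorem norm_act_projMatrix_sub_le (b c v : Plane) :
    ‖act (projMatrix b) v - act (projMatrix c) v‖ ≤ ‖b - c‖ * (‖b‖ + ‖c‖) * ‖v‖ := by
  have h : act (projMatrix b) v - act (projMatrix c) v
      = -(⟪b - c, v⟫ • b + ⟪c, v⟫ • (b - c)) := by
    rw [act_projMatrix, act_projMatrix, inner_sub_left]
    module
  rw [h, norm_neg]
  calc _ ≤ ‖b - c‖ * ‖v‖ * ‖b‖ + ‖c‖ * ‖v‖ * ‖b - c‖ := by
        refine (norm_add_le _ _).trans ?_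
        rw [norm_smul, norm_smul]
        gcongr <;> exact norm_inner_le_norm _ _
    _ = _ := by ring

/-- `P(b) v = 0` makes `v` a multiple of `b`, and a quarter turn makes it orthogonal to `b`. This
links bearing motions to signed angle motions. -/
theorem inner_act_rot_pi_div_two_eq_zero {b v : Plane} (h : act (projMatrix b) v = 0) :
    ⟪b, act (rot (Real.pi / 2)) v⟫ = 0 := by
  rw [act_projMatrix, sub_eq_zero] at h
  rw [h, inner_eq, act_rot_pi_div_two_zero, act_rot_pi_div_two_one]
  simp only [PiLp.smul_apply, smul_eq_mul]
  ring

end Plane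

/-! ### Signed angles, rigidity and the bearing energy -/

section Framework

variable {n : ℕ}

theorem bearing_swap (p : Fin n → Plane) (i j : Fin n) : bearing p j i = -bearing p i j := by
  rw [bearing, bearing, norm_sub_rev, ← smul_neg, neg_sub]

theorem norm_bearing {p : Fin n → Plane} (hp : Function.Injective p) {i j : Fin n} (h : i ≠ j) :
    ‖bearing p i j‖ = 1 := by
  have : ‖p j - p i‖ ≠ 0 := norm_ne_zero_iff.2 (sub_ne_zero.2 (hp.ne h.symm))
  rw [bearing, norm_smul, norm_inv, norm_norm, inv_mul_cancel₀ this]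

/-- This makes the true positions an equilibrium of the position estimator with true bearings. -/
theorem act_projMatrix_bearing (p : Fin n → Plane) (i j : Fin n) :
    act (projMatrix (bearing p i j)) (p i - p j) = 0 := by
  by_cases h : p i = p j
  · simp [h, act_projMatrix]
  have h0 : ‖p j - p i‖ ≠ 0 := norm_ne_zero_iff.2 (sub_ne_zero.2 (Ne.symm h))
  have h1 : p i - p j = (-‖p j - p i‖) • bearing p i j := by
    rw [bearing, smul_smul, neg_mul, mul_inv_cancel₀ h0]; simp
  have h2 : ‖bearing p i j‖ = 1 := by
    rw [bearing, norm_smul, norm_inv, norm_norm, inv_mul_cancel₀ h0]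
  rw [h1, act_smul, act_projMatrix, real_inner_self_eq_norm_sq, h2]
  simp

/-- Rotation by the signed angle takes the first bearing to the second one. -/
theorem act_rot_signedAngle {p : Fin n → Plane} (hp : Function.Injective p) {i j k : Fin n}
    (hi : j ≠ i) (hk : j ≠ k) :
    act (rot (signedAngle p i j k)) (bearing p j i) = bearing p j k := by
  have hu : bearing p j i 0 ^ 2 + bearing p j i 1 ^ 2 = 1 := by
    rw [← norm_sq_eq, norm_bearing hp hi]; norm_num
  have hw : bearing p j k 0 ^ 2 + bearing p j k 1 ^ 2 = 1 := by
    rw [← norm_sq_eq, norm_bearing hp hk]; norm_num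
  -- The two inner products are coordinates of a unit vector in an orthonormal frame, so their
  -- squares sum to one. The case distinction in `signedAngle` selects the sign of the sine.
  have hcs : Real.cos (signedAngle p i j k) = ⟪bearing p j k, bearing p j i⟫ ∧
      Real.sin (signedAngle p i j k)
        = ⟪bearing p j k, act (rot (Real.pi / 2)) (bearing p j i)⟫ := by
    have hs : ⟪bearing p j k, bearing p j i⟫ ^ 2
        + ⟪bearing p j k, act (rot (Real.pi / 2)) (bearing p j i)⟫ ^ 2 = 1 := by
      rw [inner_eq, inner_eq, act_rot_pi_div_two_zero, act_rot_pi_div_two_one]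
      linear_combination (bearing p j i 0 ^ 2 + bearing p j i 1 ^ 2) * hw + hu
    have h1 : -1 ≤ ⟪bearing p j k, bearing p j i⟫ := by nlinarith
    have h2 : ⟪bearing p j k, bearing p j i⟫ ≤ 1 := by nlinarith
    have h3 : √(1 - ⟪bearing p j k, bearing p j i⟫ ^ 2)
        = |⟪bearing p j k, act (rot (Real.pi / 2)) (bearing p j i)⟫| := by
      rw [← Real.sqrt_sq_eq_abs]; congr 1; linarith
    rw [signedAngle]
    split_ifs with h
    · exact ⟨Real.cos_arccos h1 h2, by rw [Real.sin_arccos, h3, abs_of_nonneg h]⟩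
    · rw [Real.cos_two_pi_sub, Real.sin_two_pi_sub]
      exact ⟨Real.cos_arccos h1 h2, by
        rw [Real.sin_arccos, h3, abs_of_neg (not_le.1 h), neg_neg]⟩
  obtain ⟨hc, hs⟩ := hcs
  rw [inner_eq] at hc
  rw [inner_eq, act_rot_pi_div_two_zero, act_rot_pi_div_two_one] at hs
  apply plane_ext <;>
    simp only [act_apply_zero, act_apply_one, rot, Matrix.of_apply, Matrix.cons_val',
      Matrix.cons_val_zero, Matrix.cons_val_one, Matrix.cons_val_fin_one] <;> rw [hc, hs]
  · linear_combination bearing p j k 0 * hu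
  · linear_combination bearing p j k 1 * hu

theorem act_rot_transpose_signedAngle {p : Fin n → Plane} (hp : Function.Injective p)
    {i j k : Fin n} (hi : j ≠ i) (hk : j ≠ k) :
    act (rot (signedAngle p i j k))ᵀ (bearing p j k) = bearing p j i := by
  rw [← act_rot_signedAngle hp hi hk, act_rot_transpose_act_rot]

theorem exists_of_mem_trivialMotions {p v : Fin n → Plane} (hv : v ∈ trivialMotions p) :
    ∃ (s r : ℝ) (c : Plane), ∀ i, v i = s • p i + r • act (rot (Real.pi / 2)) (p i) + c := by
  rw [trivialMotions, Submodule.mem_sup] at hv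
  obtain ⟨y, hy, z, hz, rfl⟩ := hv
  rw [Submodule.mem_sup] at hy
  obtain ⟨a, ha, b, hb, rfl⟩ := hy
  obtain ⟨s, rfl⟩ := Submodule.mem_span_singleton.1 ha
  obtain ⟨r, rfl⟩ := Submodule.mem_span_singleton.1 hb
  obtain ⟨c, d, rfl⟩ := Submodule.mem_span_pair.1 hz
  exact ⟨s, r, c • !₂[1, 0] + d • !₂[0, 1], fun i => by
    simp only [Pi.add_apply, Pi.smul_apply]⟩

/-- A trivial motion that fixes two distinct points vanishes. -/
theorem eq_zero_of_mem_trivialMotions {p v : Fin n → Plane} (hv : v ∈ trivialMotions p)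
    {a b : Fin n} (hab : p a ≠ p b) (ha : v a = 0) (hb : v b = 0) : v = 0 := by
  obtain ⟨s, r, c, h⟩ := exists_of_mem_trivialMotions hv
  -- The difference cancels the translation. What remains is multiplication of `p a - p b` by the
  -- complex number `s + r i`, which is therefore zero.
  have hd : s • (p a - p b) + r • act (rot (Real.pi / 2)) (p a - p b) = 0 := by
    have : v a - v b = 0 := by rw [ha, hb, sub_zero]
    rw [h a, h b] at this
    rw [act_sub, ← this]
    module
  set e := p a - p b with he
  have he0 : e 0 ^ 2 + e 1 ^ 2 ≠ 0 := by
    rw [← norm_sq_eq]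
    exact pow_ne_zero _ (norm_ne_zero_iff.2 (sub_ne_zero.2 hab))
  have h0 := congrArg (fun x : Plane => x 0) hd
  have h1 := congrArg (fun x : Plane => x 1) hd
  simp only [PiLp.add_apply, PiLp.smul_apply, smul_eq_mul, act_rot_pi_div_two_zero,
    act_rot_pi_div_two_one, PiLp.zero_apply] at h0 h1
  have hs : s = 0 := (mul_eq_zero.1 (by linear_combination e 0 * h0 + e 1 * h1 :
    s * (e 0 ^ 2 + e 1 ^ 2) = 0)).resolve_right he0
  have hr : r = 0 := (mul_eq_zero.1 (by linear_combination e 0 * h1 - e 1 * h0 :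
    r * (e 0 ^ 2 + e 1 ^ 2) = 0)).resolve_right he0
  subst hs hr
  have hc : c = 0 := by simpa [ha] using (h a).symm
  funext i
  simp [h i, hc]

/-- An infinitesimal bearing motion is an infinitesimal signed angle motion. -/
theorem isInfinitesimalSignedAngleMotion_of_act_projMatrix {G : SimpleGraph (Fin n)}
    {p v : Fin n → Plane}
    (h : ∀ i j, G.Adj i j → act (projMatrix (bearing p i j)) (v i - v j) = 0) :
    IsInfinitesimalSignedAngleMotion G p v := by
  have key : ∀ i j, G.Adj j i →
      ⟪bearing p j i, act (rot (Real.pi / 2)) (v i - v j)⟫ = 0 := fun i j hij => by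
    apply inner_act_rot_pi_div_two_eq_zero
    rw [← neg_sub, act_neg, h j i hij, neg_zero]
  rintro i j k ⟨-, hi, hk⟩
  rw [signedAngleRigidityRow, key i j hi, key k j hk]
  simp

open Classical in
/-- Coercivity of the bearing energy on configurations of the followers. -/
theorem exists_bearing_energy_coercive {G : SimpleGraph (Fin n)} {p : Fin n → Plane}
    (hG : IsISAR G p) {A : Finset (Fin n)} {a b : Fin n} (ha : a ∈ A) (hb : b ∈ A) (hab : a ≠ b) :
    ∃ β : ℝ, 0 < β ∧ ∀ v : Fin n → Plane, (∀ i ∈ A, v i = 0) →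
      β * ∑ i, ‖v i‖ ^ 2
        ≤ ∑ i, ∑ j with G.Adj i j, ‖act (projMatrix (bearing p i j)) (v i - v j)‖ ^ 2 := by
  -- Bearing residuals on edges, together with the anchor values. ISAR and two anchors make `Λ`
  -- injective, hence bounded below in finite dimension.
  let Λ : (Fin n → Plane) →ₗ[ℝ] (Fin n → Fin n → Plane) × (Fin n → Plane) :=
    { toFun := fun v =>
        (fun i j => if G.Adj i j then act (projMatrix (bearing p i j)) (v i - v j) else 0,
          fun i => if i ∈ A then v i else 0)
      map_add' := fun v w => by
        ext1
        · funext i j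
          simp only [Pi.add_apply, Prod.fst_add]
          split_ifs
          · rw [add_sub_add_comm, act_add]
          · simp
        · funext i
          simp only [Pi.add_apply, Prod.snd_add]
          split_ifs <;> simp
      map_smul' := fun c v => by
        ext1
        · funext i j
          simp only [Pi.smul_apply, Prod.smul_fst, RingHom.id_apply]
          split_ifs
          · rw [← smul_sub, act_smul]
          · simp
        · funext i
          simp only [Pi.smul_apply, Prod.smul_snd, RingHom.id_apply]
          split_ifs <;> simp }
  have hker : LinearMap.ker Λ = ⊥ := by
    rw [LinearMap.ker_eq_bot']
    intro v hv
    obtain ⟨h1, h2⟩ := Prod.ext_iff.1 hv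
    have hA : ∀ i ∈ A, v i = 0 := fun i hi => by simpa [Λ, hi] using congrFun h2 i
    refine eq_zero_of_mem_trivialMotions (hG.trivial_of_motion v ?_) (hG.injective.ne hab)
      (hA a ha) (hA b hb)
    refine isInfinitesimalSignedAngleMotion_of_act_projMatrix fun i j hij => ?_
    simpa [Λ, hij] using congrFun (congrFun h1 i) j
  obtain ⟨K, hK, hanti⟩ := Λ.exists_antilipschitzWith hker
  have hn : 0 < n := a.pos
  have hn' : (0 : ℝ) < n := by exact_mod_cast hn
  -- The factor `n` passes from the maximum norm to the sum of squares.
  refine ⟨((n : ℝ) * (K : ℝ) ^ 2)⁻¹, by positivity, fun v hv => ?_⟩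
  set Q := ∑ i, ∑ j with G.Adj i j, ‖act (projMatrix (bearing p i j)) (v i - v j)‖ ^ 2 with hQ
  have hQ0 : 0 ≤ Q := by positivity
  have hΛ : ‖Λ v‖ ≤ √Q := by
    refine norm_prod_le_iff.2 ⟨?_, ?_⟩
    · rw [pi_norm_le_iff_of_nonneg (Real.sqrt_nonneg _)]
      intro i
      rw [pi_norm_le_iff_of_nonneg (Real.sqrt_nonneg _)]
      intro j
      by_cases hij : G.Adj i j
      · apply Real.le_sqrt_of_sq_le
        simp only [Λ, LinearMap.coe_mk, AddHom.coe_mk, if_pos hij]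
        refine le_trans ?_ (Finset.single_le_sum (f := fun i => ∑ j with G.Adj i j,
          ‖act (projMatrix (bearing p i j)) (v i - v j)‖ ^ 2) (fun i _ => by positivity)
          (Finset.mem_univ i))
        exact Finset.single_le_sum (f := fun j =>
          ‖act (projMatrix (bearing p i j)) (v i - v j)‖ ^ 2) (fun j _ => by positivity)
          (by simpa using hij)
      · simp [Λ, hij]
    · rw [pi_norm_le_iff_of_nonneg (Real.sqrt_nonneg _)]
      intro i
      by_cases hi : i ∈ A
      · simp [Λ, hv i hi]
      · simp [Λ, hi]
  have hv' : ‖v‖ ≤ K * √Q := by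
    have h := hanti.le_mul_dist v 0
    rw [map_zero, dist_zero_right, dist_zero_right] at h
    exact h.trans (by gcongr)
  have hsum : ∑ i, ‖v i‖ ^ 2 ≤ n * (K ^ 2 * Q) := by
    calc ∑ i, ‖v i‖ ^ 2 ≤ ∑ _i : Fin n, (K * √Q) ^ 2 := by
          gcongr with i
          exact (norm_le_pi_norm v i).trans hv'
      _ = n * (K ^ 2 * Q) := by
          rw [Finset.sum_const, mul_pow, Real.sq_sqrt hQ0]; simp
  rw [inv_mul_le_iff₀ (by positivity)]
  linarith

open Classical in
/-- Summation by parts for the bearing energy. -/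
theorem sum_inner_act_projMatrix {G : SimpleGraph (Fin n)} {p : Fin n → Plane}
    (hp : Function.Injective p) (v : Fin n → Plane) :
    2 * ∑ i, ∑ j with G.Adj i j, ⟪v i, act (projMatrix (bearing p i j)) (v i - v j)⟫
      = ∑ i, ∑ j with G.Adj i j, ‖act (projMatrix (bearing p i j)) (v i - v j)‖ ^ 2 := by
  simp only [Finset.sum_filter]
  rw [two_mul]
  -- Exchanging `i` and `j` in one copy pairs the two orientations of each edge, which share the
  -- same `P`.
  nth_rewrite 2 [Finset.sum_comm]
  rw [← Finset.sum_add_distrib]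
  refine Finset.sum_congr rfl fun i _ => ?_
  rw [← Finset.sum_add_distrib]
  refine Finset.sum_congr rfl fun j _ => ?_
  by_cases hij : G.Adj i j
  · rw [if_pos hij, if_pos hij.symm, if_pos hij, norm_act_projMatrix_sq (norm_bearing hp hij.ne),
      bearing_swap p i j, projMatrix_neg, ← neg_sub (v i) (v j), act_neg, inner_neg_right,
      inner_sub_left]
    ring
  · rw [if_neg hij, if_neg (fun h => hij h.symm), if_neg hij, add_zero]

end Framework

/-! ### Bearing estimator: tree distance and convergence -/

section BearingEstimator

variable {n : ℕ}

/-- Both have `2n - 3` edges. Hence the subgraph chosen by the algorithm is all of `G`. -/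
theorem IsLaman.eq_of_le {L G : SimpleGraph (Fin n)} (hL : IsLaman L) (hG : IsLaman G)
    (h : L ≤ G) : L = G := by
  rw [← SimpleGraph.edgeSet_inj]
  refine Set.eq_of_subset_of_ncard_le (SimpleGraph.edgeSet_mono h) ?_ (Set.toFinite _)
  rw [hL.card_edges, hG.card_edges]

/-- On a Laman graph, the angle index sets found by the algorithm come from spanning trees
on the full edge set. -/
theorem IsTreeAngleIndexSet.exists_tree {G : SimpleGraph (Fin n)} {p : Fin n → Plane}
    {T : Finset (Fin n × Fin n × Fin n)} (hT : IsTreeAngleIndexSet G p T) (hG : IsLaman G) :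
    (∀ i j k, (i, j, k) ∈ T → G.Adj j i ∧ G.Adj j k) ∧
    ∃ tree : SimpleGraph G.edgeSet, tree.Connected ∧ ∀ e f, tree.Adj e f →
      ∃ i j k, (i, j, k) ∈ T ∧
        (e.1 = s(j, i) ∧ f.1 = s(j, k) ∨ e.1 = s(j, k) ∧ f.1 = s(j, i)) := by
  obtain ⟨L, hle, hL, -, tree, htree, hconn, hmem⟩ := hT
  obtain rfl := hL.eq_of_le hG hle
  refine ⟨fun i j k h => ?_, tree, hconn.connected, fun e f hef => ?_⟩
  · obtain ⟨-, hi, hk, -⟩ := (hmem i j k).1 h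
    exact ⟨hi, hk⟩
  · have h := htree hef
    rw [angleIndexGraph, SimpleGraph.fromRel_adj] at h
    obtain ⟨-, ⟨i, j, k, ⟨hik, hi, hk⟩, he, hf⟩ | ⟨i, j, k, ⟨hik, hi, hk⟩, hf, he⟩⟩ := h
    · refine ⟨i, j, k, (hmem i j k).2 ⟨hik, hi, hk, ?_⟩, Or.inl ⟨he, hf⟩⟩
      convert hef using 1
      · exact Subtype.ext he.symm
      · exact Subtype.ext hf.symm
    · refine ⟨i, j, k, (hmem i j k).2 ⟨hik, hi, hk, ?_⟩, Or.inr ⟨he, hf⟩⟩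
      convert hef.symm using 1
      · exact Subtype.ext hf.symm
      · exact Subtype.ext he.symm

open Classical in
/-- The terms of the bearing estimator of the directed edge `x`. -/
def bearingArcs (T : Finset (Fin n × Fin n × Fin n)) (x : Fin n × Fin n) :
    Finset (Fin 4 × Fin n) :=
  {m | ![(x.2, x.1, m.2), (m.2, x.1, x.2), (x.1, x.2, m.2), (m.2, x.2, x.1)] m.1 ∈ T}

/-- The directed edge whose estimate occurs in a term of the bearing estimator of `x`. -/
def bearingTarget (x : Fin n × Fin n) (m : Fin 4 × Fin n) : Fin n × Fin n :=
  ![(x.1, m.2), (x.1, m.2), (x.2, m.2), (x.2, m.2)] m.1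

/-- The coupling isometry in a term of the bearing estimator of `x`. -/
def bearingCoupling (p : Fin n → Plane) (x : Fin n × Fin n) (m : Fin 4 × Fin n) (v : Plane) :
    Plane :=
  ![act (rot (signedAngle p x.2 x.1 m.2))ᵀ v, act (rot (signedAngle p m.2 x.1 x.2)) v,
    -act (rot (signedAngle p x.1 x.2 m.2))ᵀ v, -act (rot (signedAngle p m.2 x.2 x.1)) v] m.1

theorem norm_bearingCoupling (p : Fin n → Plane) (x : Fin n × Fin n) (m : Fin 4 × Fin n)
    (v : Plane) : ‖bearingCoupling p x m v‖ = ‖v‖ := by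
  obtain ⟨s, k⟩ := m
  fin_cases s <;> simp [bearingCoupling, rot_transpose, norm_act_rot]

/-- The bearing estimator in terms of arcs, for arbitrary estimates. -/
theorem bearingField_eq_neg_sum (p : Fin n → Plane) (T : Finset (Fin n × Fin n × Fin n))
    (b : Fin n → Fin n → Plane) (x : Fin n × Fin n) :
    bearingField p T b x.1 x.2 = -∑ m ∈ bearingArcs T x,
      (b x.1 x.2 - bearingCoupling p x m (b (bearingTarget x m).1 (bearingTarget x m).2)) := by
  simp only [bearingField, bearingArcs, Finset.sum_filter, Fintype.sum_prod_type,
    Fin.sum_univ_four, bearingCoupling, bearingTarget, Matrix.cons_val, sub_neg_eq_add]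
  congr!

/-- The arcs fix the true bearings. -/
theorem bearingCoupling_bearing {p : Fin n → Plane} (hp : Function.Injective p)
    {G : SimpleGraph (Fin n)} {T : Finset (Fin n × Fin n × Fin n)}
    (hT : ∀ i j k, (i, j, k) ∈ T → G.Adj j i ∧ G.Adj j k) {x : Fin n × Fin n}
    {m : Fin 4 × Fin n} (hm : m ∈ bearingArcs T x) :
    G.Adj (bearingTarget x m).1 (bearingTarget x m).2 ∧
      bearingCoupling p x m (bearing p (bearingTarget x m).1 (bearingTarget x m).2)
        = bearing p x.1 x.2 := by
  obtain ⟨s, k⟩ := m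
  obtain ⟨i, j⟩ := x
  rw [bearingArcs, Finset.mem_filter] at hm
  replace hm := hm.2
  -- The four values of `s` are the four sums of `bearingField`. In the last two the shared vertex
  -- is the head of the edge, so the reversal `b_{ij} = -b_{ji}` accounts for the minus sign.
  fin_cases s <;> obtain ⟨h1, h2⟩ := hT _ _ _ hm
  · exact ⟨h2, act_rot_transpose_signedAngle hp h1.ne h2.ne⟩
  · exact ⟨h1, act_rot_signedAngle hp h1.ne h2.ne⟩
  · refine ⟨h2, ?_⟩
    change -act _ _ = _
    rw [bearing_swap p j i, ← act_rot_transpose_signedAngle hp h1.ne h2.ne]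
    rfl
  · refine ⟨h1, ?_⟩
    change -act _ _ = _
    rw [bearing_swap p j i, ← act_rot_signedAngle hp h1.ne h2.ne]
    rfl

theorem bearingCoupling_sub (p : Fin n → Plane) (x : Fin n × Fin n) (m : Fin 4 × Fin n)
    (v w : Plane) :
    bearingCoupling p x m (v - w) = bearingCoupling p x m v - bearingCoupling p x m w := by
  obtain ⟨s, k⟩ := m
  fin_cases s <;> simp [bearingCoupling, act_sub] <;> abel

/-- Take the first step of a shortest walk. -/
theorem _root_.SimpleGraph.Connected.exists_adj_dist_lt {V : Type*} {G : SimpleGraph V}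
    (hG : G.Connected) {u v : V} (huv : u ≠ v) : ∃ w, G.Adj u w ∧ G.dist w v < G.dist u v := by
  obtain ⟨w, hw⟩ := hG.exists_walk_length_eq_dist u v
  cases w with
  | nil => exact absurd rfl huv
  | cons h w' =>
    refine ⟨_, h, ?_⟩
    rw [← hw, SimpleGraph.Walk.length_cons]
    exact Nat.lt_succ_of_le (SimpleGraph.dist_le w')

/-- Every edge that does not join two anchors has an arc to an edge that is closer to the
anchors. -/
theorem exists_bearing_depth {G : SimpleGraph (Fin n)} {p : Fin n → Plane}
    {A : Finset (Fin n)} {T : Finset (Fin n × Fin n × Fin n)}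
    (hT : IsTreeAngleIndexSet G p T) (hG : IsLaman G) {a b : Fin n} (ha : a ∈ A) (hb : b ∈ A)
    (hab : G.Adj a b) :
    ∃ d : Fin n × Fin n → ℕ, ∀ x : Fin n × Fin n, G.Adj x.1 x.2 → ¬ (x.1 ∈ A ∧ x.2 ∈ A) →
      ∃ m ∈ bearingArcs T x, d (bearingTarget x m) < d x := by
  classical
  obtain ⟨-, tree, hconn, hadj⟩ := hT.exists_tree hG
  let e₀ : G.edgeSet := ⟨s(a, b), hab⟩
  -- Both orientations get the tree distance to the anchor edge `e₀`. The value `0` off the edge set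
  -- is never compared.
  refine ⟨fun x => if h : s(x.1, x.2) ∈ G.edgeSet then tree.dist ⟨_, h⟩ e₀ else 0, ?_⟩
  rintro ⟨i, j⟩ hij hA
  let e : G.edgeSet := ⟨s(i, j), hij⟩
  have hne : e ≠ e₀ := fun h => by
    have h' : s(i, j) = s(a, b) := congrArg Subtype.val h
    rcases Sym2.eq_iff.1 h' with ⟨rfl, rfl⟩ | ⟨rfl, rfl⟩
    · exact hA ⟨ha, hb⟩
    · exact hA ⟨hb, ha⟩
  obtain ⟨f, hef, hlt⟩ : ∃ f, tree.Adj e f ∧ tree.dist f e₀ < tree.dist e e₀ :=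
    hconn.exists_adj_dist_lt hne
  have key : ∀ u v : Fin n, f.1 = s(u, v) →
      (if h : s(u, v) ∈ G.edgeSet then tree.dist ⟨_, h⟩ e₀ else 0)
        < if h : s(i, j) ∈ G.edgeSet then tree.dist ⟨_, h⟩ e₀ else 0 := by
    intro u v huv
    have hmem : s(u, v) ∈ G.edgeSet := huv ▸ f.2
    have hf : (⟨s(u, v), hmem⟩ : G.edgeSet) = f := Subtype.ext huv.symm
    rw [dif_pos hmem, dif_pos (show s(i, j) ∈ G.edgeSet from hij), hf]
    exact hlt
  -- Which end of the triple `e` occupies, and its orientation, decide which of the four sums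
  -- contains the arc.
  obtain ⟨i', j', k', hmem, ⟨he, hf⟩ | ⟨he, hf⟩⟩ := hadj e f hef <;>
    rcases Sym2.eq_iff.1 (show s(i, j) = _ from he) with ⟨rfl, rfl⟩ | ⟨rfl, rfl⟩
  · exact ⟨(0, k'), by simpa [bearingArcs] using hmem, key _ _ hf⟩
  · exact ⟨(2, k'), by simpa [bearingArcs] using hmem, key _ _ hf⟩
  · exact ⟨(1, i'), by simpa [bearingArcs] using hmem, key _ _ hf⟩
  · exact ⟨(3, i'), by simpa [bearingArcs] using hmem, key _ _ hf⟩

/-- Exponential convergence of the bearing estimates. -/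
theorem exists_bearing_rate {G : SimpleGraph (Fin n)} {p : Fin n → Plane}
    {A : Finset (Fin n)} {T : Finset (Fin n × Fin n × Fin n)} (hnet : IsAdmissibleNetwork G p A)
    (hT : IsTreeAngleIndexSet G p T) :
    ∃ μ : ℝ, 0 < μ ∧ ∀ b : ℝ → Fin n → Fin n → Plane,
      (∀ t, 0 ≤ t → ∀ i ∈ A, ∀ j ∈ A, G.Adj i j → b t i j = bearing p i j) →
      (∀ t, 0 ≤ t → ∀ i j, G.Adj i j → ¬ (i ∈ A ∧ j ∈ A) →
        HasDerivWithinAt (fun s => b s i j) (bearingField p T (b t) i j) (Ici 0) t) →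
      ∃ C : ℝ, 0 ≤ C ∧ ∀ t, 0 ≤ t → ∀ i j, G.Adj i j →
        ‖b t i j - bearing p i j‖ ≤ C * Real.exp (-μ * t) := by
  classical
  obtain ⟨a, ha, c, hc, hac⟩ := hnet.exists_adj
  obtain ⟨hTadj, -⟩ := hT.exists_tree hnet.isLaman
  obtain ⟨d, hd⟩ := exists_bearing_depth hT hnet.isLaman ha hc hac
  obtain ⟨μ, hμ, h⟩ := exists_consensus_rate
    {x : Fin n × Fin n | G.Adj x.1 x.2 ∧ ¬ (x.1 ∈ A ∧ x.2 ∈ A)} (bearingArcs T) bearingTarget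
    (bearingCoupling p) (fun x m v => (norm_bearingCoupling p x m v).le) d
    (fun x hx => hd x hx.1 hx.2)
  refine ⟨μ, hμ, fun b hbA hb => ?_⟩
  -- Non-adjacent pairs get error zero and so count as leaders, like the edges between anchors.
  set e : ℝ → Fin n × Fin n → Plane := fun t x =>
    if G.Adj x.1 x.2 then b t x.1 x.2 - bearing p x.1 x.2 else 0 with he
  have h0 : ∀ t, 0 ≤ t → ∀ x ∉ {x : Fin n × Fin n | G.Adj x.1 x.2 ∧ ¬ (x.1 ∈ A ∧ x.2 ∈ A)},
      e t x = 0 := fun t ht x hx => by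
    simp only [he]
    split_ifs with hadj
    · have hx' : x.1 ∈ A ∧ x.2 ∈ A := by
        by_contra hcon
        exact hx ⟨hadj, hcon⟩
      rw [hbA t ht _ hx'.1 _ hx'.2 hadj, sub_self]
    · rfl
  obtain ⟨C, hC, hCe⟩ := h e h0 fun t ht x hx => by
    have h1 := (hb t ht x.1 x.2 hx.1 hx.2).sub_const (bearing p x.1 x.2)
    simp only [he, if_pos hx.1]
    convert! h1 using 1
    rw [bearingField_eq_neg_sum]
    congr 1
    refine Finset.sum_congr rfl fun m hm => ?_
    obtain ⟨h2, h3⟩ := bearingCoupling_bearing hnet.isISAR.injective hTadj hm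
    rw [if_pos h2, bearingCoupling_sub, h3]
    abel
  refine ⟨C, hC, fun t ht i j hij => ?_⟩
  simpa [he, hij] using hCe t ht (i, j)

end BearingEstimator

/-! ### Position estimator: Lyapunov estimate -/

section PositionEstimator

variable {n : ℕ}

open Classical in
/-- The position estimator as a perturbation of the bearing Laplacian, tested against the error. -/
theorem sum_inner_positionField_le {G : SimpleGraph (Fin n)} {p q : Fin n → Plane}
    {b : Fin n → Fin n → Plane} (hp : Function.Injective p) {A : Finset (Fin n)} {β δ R : ℝ}
    (hcoer : ∀ v : Fin n → Plane, (∀ i ∈ A, v i = 0) → β * ∑ i, ‖v i‖ ^ 2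
      ≤ ∑ i, ∑ j with G.Adj i j, ‖act (projMatrix (bearing p i j)) (v i - v j)‖ ^ 2)
    (hqA : ∀ i ∈ A, q i = p i) (hR : ∀ i j, ‖p i - p j‖ ≤ R)
    (hδ : ∀ i j, G.Adj i j → ‖b i j - bearing p i j‖ * (‖b i j‖ + 1) ≤ δ) (hδ0 : 0 ≤ δ)
    (hR0 : 0 ≤ R) :
    ∑ i, 2 * ⟪q i - p i, positionField G q b i⟫
      ≤ -β * ∑ i, ‖q i - p i‖ ^ 2
        + 2 * (n * n * (δ * (2 + R))) * (∑ i, ‖q i - p i‖ ^ 2 + 1) := by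
  classical
  set x : Fin n → Plane := fun i => q i - p i with hx
  set V : ℝ := ∑ i, ‖x i‖ ^ 2 with hV
  have hV0 : 0 ≤ V := by positivity
  have hxV : ∀ i, ‖x i‖ ≤ √V := fun i => Real.le_sqrt_of_sq_le
    (Finset.single_le_sum (f := fun i => ‖x i‖ ^ 2) (fun i _ => by positivity)
      (Finset.mem_univ i))
  -- The true `P` annihilates `p i - p j`, so the main part depends only on the error `x`; the rest
  -- is due to the bearing error.
  have hsplit : ∀ i j, act (projMatrix (b i j)) (q i - q j)
      = act (projMatrix (bearing p i j)) (x i - x j)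
        + (act (projMatrix (b i j)) (q i - q j)
          - act (projMatrix (bearing p i j)) (q i - q j)) := fun i j => by
    have h1 : q i - q j = (x i - x j) + (p i - p j) := by simp only [hx]; abel
    have h2 : act (projMatrix (bearing p i j)) (q i - q j)
        = act (projMatrix (bearing p i j)) (x i - x j) := by
      rw [h1, act_add, act_projMatrix_bearing, add_zero]
    rw [h2]
    abel
  have hterm : ∀ i j, G.Adj i j → -⟪x i, act (projMatrix (b i j)) (q i - q j)
      - act (projMatrix (bearing p i j)) (q i - q j)⟫ ≤ δ * (2 + R) * (V + 1) := by
    intro i j hij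
    have h1 := norm_act_projMatrix_sub_le (b i j) (bearing p i j) (q i - q j)
    rw [norm_bearing hp hij.ne] at h1
    have h2 : ‖q i - q j‖ ≤ 2 * √V + R := by
      have h3 : q i - q j = x i - x j + (p i - p j) := by simp only [hx]; abel
      rw [h3]
      have := norm_add_le (x i - x j) (p i - p j)
      have := norm_sub_le (x i) (x j)
      linarith [hxV i, hxV j, hR i j]
    have hs0 := Real.sqrt_nonneg V
    have hs : √V ^ 2 = V := Real.sq_sqrt hV0
    calc _ ≤ ‖x i‖ * ‖act (projMatrix (b i j)) (q i - q j)
          - act (projMatrix (bearing p i j)) (q i - q j)‖ :=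
          (neg_le_abs _).trans (abs_real_inner_le_norm _ _)
      _ ≤ √V * (δ * (2 * √V + R)) := by
          refine mul_le_mul (hxV i) (h1.trans ?_) (norm_nonneg _) hs0
          exact mul_le_mul (hδ i j hij) h2 (norm_nonneg _) hδ0
      _ = δ * (2 * √V ^ 2 + R * √V) := by ring
      _ ≤ δ * ((2 + R) * (V + 1)) := by
          refine mul_le_mul_of_nonneg_left ?_ hδ0
          -- Makes the perturbation affine in `V`, as the scalar comparison requires.
          have h4 : √V ≤ V + 1 := by nlinarith
          have h5 : R * √V ≤ R * (V + 1) := by gcongr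
          rw [hs]
          linarith
      _ = _ := by ring
  have hpert : ∑ i, ∑ j with G.Adj i j, -⟪x i, act (projMatrix (b i j)) (q i - q j)
      - act (projMatrix (bearing p i j)) (q i - q j)⟫ ≤ n * n * (δ * (2 + R)) * (V + 1) := by
    have hB : 0 ≤ δ * (2 + R) * (V + 1) := by positivity
    calc _ ≤ ∑ _i : Fin n, ∑ _j : Fin n, δ * (2 + R) * (V + 1) := by
          refine Finset.sum_le_sum fun i _ => ?_
          rw [Finset.sum_filter]
          refine Finset.sum_le_sum fun j _ => ?_
          split_ifs with hij
          · exact hterm i j hij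
          · exact hB
      _ = _ := by simp; ring
  have henergy := sum_inner_act_projMatrix (G := G) hp x
  have hco := hcoer x fun i hi => by simp [hx, hqA i hi]
  have hfield : ∀ i, 2 * ⟪x i, positionField G q b i⟫
      = -(2 * ∑ j with G.Adj i j, ⟪x i, act (projMatrix (bearing p i j)) (x i - x j)⟫)
        + 2 * ∑ j with G.Adj i j, -⟪x i, act (projMatrix (b i j)) (q i - q j)
          - act (projMatrix (bearing p i j)) (q i - q j)⟫ := fun i => by
    rw [positionField, inner_neg_right, inner_sum, Finset.sum_neg_distrib,
      Finset.sum_congr rfl fun j _ => by rw [hsplit i j, inner_add_right],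
      Finset.sum_add_distrib]
    ring
  change ∑ i, 2 * ⟪x i, positionField G q b i⟫ ≤ _
  rw [Finset.sum_congr rfl fun i _ => hfield i, Finset.sum_add_distrib, Finset.sum_neg_distrib,
    ← Finset.mul_sum, ← Finset.mul_sum]
  linarith

/-- Exponential convergence of the position estimates, driven by exponentially convergent bearing
estimates. -/
theorem exists_position_rate {G : SimpleGraph (Fin n)} {p : Fin n → Plane}
    (hG : IsISAR G p) {A : Finset (Fin n)} (hA : 2 ≤ A.card) {μ : ℝ} (hμ : 0 < μ) :
    ∃ lam : ℝ, 0 < lam ∧ ∀ (q : ℝ → Fin n → Plane) (b : ℝ → Fin n → Fin n → Plane),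
      (∀ t, 0 ≤ t → ∀ i ∈ A, q t i = p i) →
      (∀ t, 0 ≤ t → ∀ i ∉ A,
        HasDerivWithinAt (fun s => q s i) (positionField G (q t) (b t) i) (Ici 0) t) →
      (∃ C : ℝ, 0 ≤ C ∧ ∀ t, 0 ≤ t → ∀ i j, G.Adj i j →
        ‖b t i j - bearing p i j‖ ≤ C * Real.exp (-μ * t)) →
      ∃ C : ℝ, ∀ i, ∀ t, 0 ≤ t → ‖q t i - p i‖ ≤ C * Real.exp (-lam * t) := by
  classical
  obtain ⟨a, ha, a', ha', haa'⟩ := Finset.one_lt_card.1 hA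
  obtain ⟨β, hβ, hcoer⟩ := exists_bearing_energy_coercive hG ha ha' haa'
  -- The comparison needs `γ < μ` strictly. The final rate is `γ / 2` because `V` is quadratic in
  -- the error.
  set γ : ℝ := min β (μ / 2) with hγ
  have hγ0 : 0 < γ := by positivity
  refine ⟨γ / 2, by positivity, fun q b hqA hq ⟨C, hC, hb⟩ => ?_⟩
  set R : ℝ := ∑ i, ∑ j, ‖p i - p j‖ with hRdef
  have hR : ∀ i j, ‖p i - p j‖ ≤ R := fun i j =>
    (Finset.single_le_sum (f := fun j => ‖p i - p j‖) (fun j _ => norm_nonneg _)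
      (Finset.mem_univ j)).trans
    (Finset.single_le_sum (f := fun i => ∑ j, ‖p i - p j‖)
      (fun i _ => Finset.sum_nonneg fun j _ => norm_nonneg _) (Finset.mem_univ i))
  have hR0 : 0 ≤ R := by positivity
  set V : ℝ → ℝ := fun t => ∑ i, ‖q t i - p i‖ ^ 2 with hV
  have hV0 : ∀ t, 0 ≤ V t := fun t => by positivity
  have hderiv : ∀ t, 0 ≤ t → HasDerivWithinAt V
      (∑ i, 2 * ⟪q t i - p i, positionField G (q t) (b t) i⟫) (Ici 0) t := fun t ht => by
    refine HasDerivWithinAt.fun_sum fun i _ => ?_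
    by_cases hi : i ∈ A
    -- Anchors do not follow `positionField`, but their error is zero, so summing over all vertices
    -- is harmless.
    · rw [hqA t ht i hi, sub_self, inner_zero_left, mul_zero]
      refine (hasDerivWithinAt_const t (Ici 0) (0 : ℝ)).congr (fun s hs => ?_) ?_
      · simp [hqA s hs i hi]
      · simp [hqA t ht i hi]
    · exact ((hq t ht i hi).sub_const (p i)).norm_sq
  have hexp1 : ∀ t, 0 ≤ t → Real.exp (-μ * t) ≤ 1 := fun t ht =>
    Real.exp_le_one_iff.2 (by nlinarith)
  have hdiff : ∀ t, 0 ≤ t → ∑ i, 2 * ⟪q t i - p i, positionField G (q t) (b t) i⟫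
      ≤ -γ * V t + 2 * (n * n * (C * (C + 2) * (2 + R))) * Real.exp (-μ * t) * (V t + 1) := by
    intro t ht
    have hδ : ∀ i j, G.Adj i j → ‖b t i j - bearing p i j‖ * (‖b t i j‖ + 1)
        ≤ C * Real.exp (-μ * t) * (C + 2) := fun i j hij => by
      have h1 := hb t ht i j hij
      have h2 := norm_le_norm_add_norm_sub' (b t i j) (bearing p i j)
      rw [norm_bearing hG.injective hij.ne] at h2
      have h3 : C * Real.exp (-μ * t) ≤ C * 1 := by gcongr; exact hexp1 t ht
      refine mul_le_mul h1 (by linarith) (by positivity) (by positivity)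
    have h := sum_inner_positionField_le hG.injective (q := q t) (b := b t) (A := A) (R := R)
      (fun v hv => hcoer v hv) (hqA t ht) hR hδ (by positivity) hR0
    have hγβ : γ * V t ≤ β * V t := 
      mul_le_mul_of_nonneg_right (min_le_left _ _) (hV0 t)
    refine h.trans ?_
    change -β * V t + _ * (V t + 1) ≤ _
    have : 2 * (n * n * (C * Real.exp (-μ * t) * (C + 2) * (2 + R))) * (V t + 1)
        = 2 * (n * n * (C * (C + 2) * (2 + R))) * Real.exp (-μ * t) * (V t + 1) := by ring
    linarith
  obtain ⟨B, hB⟩ := exists_le_exp_of_deriv_le (V := V) (γ := γ) (μ := μ)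
    (K := 2 * (n * n * (C * (C + 2) * (2 + R))))
    ((min_le_right _ _).trans_lt (by linarith)) (fun t _ => hV0 t) hderiv hdiff
    (by positivity) hγ0.le
  refine ⟨√B, fun i t ht => ?_⟩
  have hB0 : 0 ≤ B := by
    have := (hV0 0).trans (hB 0 le_rfl)
    simpa using this
  have h1 : ‖q t i - p i‖ ^ 2 ≤ V t :=
    Finset.single_le_sum (f := fun i => ‖q t i - p i‖ ^ 2) (fun i _ => by positivity)
      (Finset.mem_univ i)
  refine abs_le_of_sq_le_sq' ?_ (by positivity) |>.2
  rw [mul_pow, Real.sq_sqrt hB0, ← Real.exp_nat_mul]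
  refine (h1.trans (hB t ht)).trans (le_of_eq ?_)
  congr 2
  push_cast
  ring

end PositionEstimator

/-! ### Global existence of trajectories -/

section Existence

variable {n : ℕ}

/-- With `bearingField_smul`, this makes the bearing field a linear map on a finite-dimensional
space, hence globally Lipschitz. -/
theorem bearingField_add (p : Fin n → Plane) (T : Finset (Fin n × Fin n × Fin n))
    (b c : Fin n → Fin n → Plane) (i j : Fin n) :
    bearingField p T (b + c) i j = bearingField p T b i j + bearingField p T c i j := by
  simp only [bearingField, Pi.add_apply, act_add, add_sub_add_comm, add_add_add_comm _ _ (act _ _),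
    Finset.sum_add_distrib]
  abel

theorem bearingField_smul (p : Fin n → Plane) (T : Finset (Fin n × Fin n × Fin n))
    (r : ℝ) (b : Fin n → Fin n → Plane) (i j : Fin n) :
    bearingField p T (r • b) i j = r • bearingField p T b i j := by
  simp only [bearingField, Pi.smul_apply, act_smul, ← smul_sub, ← smul_add, ← Finset.smul_sum,
    smul_neg]

/-- A function on `[0, ∞)` with zero derivative is constant. -/
theorem eq_of_hasDerivWithinAt_zero {f : ℝ → Plane}
    (hf : ∀ t, 0 ≤ t → HasDerivWithinAt f 0 (Ici 0) t) {t : ℝ} (ht : 0 ≤ t) : f t = f 0 :=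
  constant_of_has_deriv_right_zero
    (fun s hs => (hf s hs.1).continuousWithinAt.mono Icc_subset_Ici_self)
    (fun s hs => (hf s hs.1).mono (Ici_subset_Ici.2 hs.1)) t ⟨ht, le_rfl⟩

/-- The bearing estimator has a solution for all initial values. -/
theorem exists_bearing_solution (G : SimpleGraph (Fin n)) (p : Fin n → Plane)
    (A : Finset (Fin n)) (T : Finset (Fin n × Fin n × Fin n)) (b₀ : Fin n → Fin n → Plane) :
    ∃ b : ℝ → Fin n → Fin n → Plane, Continuous b ∧
      (∀ t, 0 ≤ t → ∀ i ∈ A, ∀ j ∈ A, G.Adj i j → b t i j = bearing p i j) ∧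
      (∀ t, 0 ≤ t → ∀ i j, G.Adj i j → ¬ (i ∈ A ∧ j ∈ A) →
        HasDerivWithinAt (fun s => b s i j) (bearingField p T (b t) i j) (Ici 0) t) ∧
      ∀ i j, G.Adj i j → ¬ (i ∈ A ∧ j ∈ A) → b 0 i j = b₀ i j := by
  classical
  -- Zero velocity between anchors keeps those components at their initial value, the true bearing.
  let F : (Fin n → Fin n → Plane) →ₗ[ℝ] (Fin n → Fin n → Plane) :=
    { toFun := fun b i j => if i ∈ A ∧ j ∈ A then 0 else bearingField p T b i j
      map_add' := fun b c => by
        funext i j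
        simp only [Pi.add_apply]
        split_ifs
        · simp
        · exact bearingField_add p T b c i j
      map_smul' := fun r b => by
        funext i j
        simp only [Pi.smul_apply, RingHom.id_apply]
        split_ifs
        · simp
        · exact bearingField_smul p T r b i j }
  let Φ := LinearMap.toContinuousLinearMap F
  obtain ⟨b, hb0, hbc, hb⟩ := exists_forward_solution (f := fun _ b => Φ b) (K := ‖Φ‖) (M := 0)
    (Φ.continuous.comp continuous_snd)
    (fun _ x y => by rw [← map_sub]; exact Φ.le_opNorm _) (fun _ => by simp)
    (fun i j => if i ∈ A ∧ j ∈ A then bearing p i j else b₀ i j)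
  have hcomp : ∀ t, 0 ≤ t → ∀ i j, HasDerivWithinAt (fun s => b s i j)
      (if i ∈ A ∧ j ∈ A then 0 else bearingField p T (b t) i j) (Ici 0) t := fun t ht i j =>
    hasDerivWithinAt_pi.1 (hasDerivWithinAt_pi.1 (hb t ht) i) j
  refine ⟨b, hbc, fun t ht i hi j hj _ => ?_, fun t ht i j _ hA => ?_, fun i j _ hA => ?_⟩
  · rw [eq_of_hasDerivWithinAt_zero (f := fun s => b s i j)
      (fun s hs => by simpa [hi, hj] using hcomp s hs i j) ht, hb0]
    simp [hi, hj]
  · simpa [hA] using hcomp t ht i j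
  · rw [hb0]
    simp [hA]

theorem norm_act_projMatrix_le (b v : Plane) :
    ‖act (projMatrix b) v‖ ≤ (1 + ‖b‖ ^ 2) * ‖v‖ := by
  rw [act_projMatrix]
  calc _ ≤ ‖v‖ + ‖b‖ * ‖v‖ * ‖b‖ := by
        refine (norm_sub_le _ _).trans ?_
        rw [norm_smul]
        gcongr
        exact norm_inner_le_norm _ _
    _ = _ := by ring

/-- The position estimator has a solution for all initial values, given bounded bearing
estimates. -/
theorem exists_position_solution (G : SimpleGraph (Fin n)) (p : Fin n → Plane)
    (A : Finset (Fin n)) {b : ℝ → Fin n → Fin n → Plane} (hbc : Continuous b) {C : ℝ}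
    (hb : ∀ t, 0 ≤ t → ∀ i j, G.Adj i j → ‖b t i j‖ ≤ C) (q₀ : Fin n → Plane) :
    ∃ q : ℝ → Fin n → Plane,
      (∀ t, 0 ≤ t → ∀ i ∈ A, q t i = p i) ∧
      (∀ t, 0 ≤ t → ∀ i ∉ A,
        HasDerivWithinAt (fun s => q s i) (positionField G (q t) (b t) i) (Ici 0) t) ∧
      ∀ i ∉ A, q 0 i = q₀ i := by
  classical
  -- The bearing bound holds only for `t ≥ 0`; `max t 0` gives a Lipschitz constant valid at all
  -- real times.
  set f : ℝ → (Fin n → Plane) → Fin n → Plane := fun t q i =>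
    if i ∈ A then 0 else positionField G q (b (max t 0)) i with hf
  have hfc : Continuous (Function.uncurry f) := by
    refine continuous_pi fun i => ?_
    by_cases hi : i ∈ A
    · simpa [hf, hi, Function.uncurry] using continuous_const
    · simp only [hf, hi, Function.uncurry, positionField, act_projMatrix, if_false]
      have h1 : ∀ j, Continuous fun x : ℝ × (Fin n → Plane) => b (max x.1 0) i j := fun j =>
        (continuous_apply j).comp ((continuous_apply i).comp
          (hbc.comp (continuous_fst.max continuous_const)))
      have h2 : ∀ j, Continuous fun x : ℝ × (Fin n → Plane) => x.2 j := fun j =>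
        (continuous_apply j).comp continuous_snd
      refine (continuous_finsetSum _ fun j _ => ?_).neg
      have h3 : Continuous fun x : ℝ × (Fin n → Plane) => x.2 i - x.2 j := (h2 i).sub (h2 j)
      have h4 : Continuous fun x : ℝ × (Fin n → Plane) =>
          ⟪b (max x.1 0) i j, x.2 i - x.2 j⟫ := (h1 j).inner h3
      exact h3.sub (h4.smul (h1 j))
  have hlip : ∀ t x y, ‖f t x - f t y‖ ≤ (n * ((1 + C ^ 2) * 2)) * ‖x - y‖ := by
    intro t x y
    rw [pi_norm_le_iff_of_nonneg (by positivity)]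
    intro i
    by_cases hi : i ∈ A
    · simp only [hf, hi, if_true, Pi.sub_apply, sub_self, norm_zero]
      positivity
    · have hsub : f t x i - f t y i = -∑ j with G.Adj i j,
          act (projMatrix (b (max t 0) i j)) ((x - y) i - (x - y) j) := by
        simp only [hf, hi, if_false, positionField]
        rw [neg_sub_neg, ← neg_sub, ← Finset.sum_sub_distrib]
        congr 1
        refine Finset.sum_congr rfl fun j _ => ?_
        rw [← act_sub]
        congr 1
        simp only [Pi.sub_apply]
        abel
      rw [Pi.sub_apply, hsub, norm_neg, Finset.sum_filter]
      calc _ ≤ ∑ _j : Fin n, (1 + C ^ 2) * (2 * ‖x - y‖) := by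
            refine (norm_sum_le _ _).trans (Finset.sum_le_sum fun j _ => ?_)
            split_ifs with hij
            · refine (norm_act_projMatrix_le _ _).trans ?_
              have h1 := hb (max t 0) (le_max_right _ _) i j hij
              have h2 := norm_sub_le ((x - y) i) ((x - y) j)
              have h3 := norm_le_pi_norm (x - y) i
              have h4 := norm_le_pi_norm (x - y) j
              gcongr
              linarith
            · rw [norm_zero]
              positivity
        _ = _ := by simp; ring
  obtain ⟨q, hq0, -, hq⟩ := exists_forward_solution (f := f) (M := 0) hfc hlip
    (fun t => by
      refine le_of_eq (norm_eq_zero.2 ?_)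
      funext i
      simp [hf, positionField, act_projMatrix])
    (fun i => if i ∈ A then p i else q₀ i)
  have hcomp : ∀ t, 0 ≤ t → ∀ i, HasDerivWithinAt (fun s => q s i) (f t (q t) i) (Ici 0) t :=
    fun t ht i => hasDerivWithinAt_pi.1 (hq t ht) i
  refine ⟨q, fun t ht i hi => ?_, fun t ht i hi => ?_, fun i hi => ?_⟩
  · rw [eq_of_hasDerivWithinAt_zero (f := fun s => q s i)
      (fun s hs => by simpa [hf, hi] using hcomp s hs i) ht, hq0]
    simp [hi]
  · simpa [hf, hi, max_eq_left ht] using hcomp t ht i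
  · rw [hq0]
    simp [hi]

end Existence

end SignedAngle

end

/-- Global exponential convergence of the signed angle based localization protocol: for arbitrary
initial estimates the protocol has a trajectory on `[0, ∞)`, and along every trajectory the
position estimates of all followers converge exponentially to the true positions. -/
theorem theorem10 {n : ℕ} (G : SimpleGraph (Fin n)) (p : Fin n → SignedAngle.Plane)
    (A : Finset (Fin n)) (T : Finset (Fin n × Fin n × Fin n))
    (hnet : SignedAngle.IsAdmissibleNetwork G p A)
    (hT : SignedAngle.IsTreeAngleIndexSet G p T) :
    (∀ (q₀ : Fin n → SignedAngle.Plane) (b₀ : Fin n → Fin n → SignedAngle.Plane),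
      ∃ (q : ℝ → Fin n → SignedAngle.Plane) (b : ℝ → Fin n → Fin n → SignedAngle.Plane),
        SignedAngle.IsTrajectory G p A T q b ∧
        (∀ i ∉ A, q 0 i = q₀ i) ∧
        (∀ i j : Fin n, G.Adj i j → ¬ (i ∈ A ∧ j ∈ A) → b 0 i j = b₀ i j)) ∧
    ∃ lam : ℝ, 0 < lam ∧
      ∀ (q : ℝ → Fin n → SignedAngle.Plane) (b : ℝ → Fin n → Fin n → SignedAngle.Plane),
        SignedAngle.IsTrajectory G p A T q b →
        ∃ C : ℝ, ∀ i ∉ A, ∀ t : ℝ, 0 ≤ t → ‖q t i - p i‖ ≤ C * Real.exp (-lam * t) := by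
  obtain ⟨μ, hμ, hbearing⟩ := SignedAngle.exists_bearing_rate hnet hT
  refine ⟨fun q₀ b₀ => ?_, ?_⟩
  -- The bearings are solved first; their convergence supplies the uniform bound needed to solve for
  -- the positions.
  · obtain ⟨b, hbc, hbA, hb, hb0⟩ := SignedAngle.exists_bearing_solution G p A T b₀
    obtain ⟨C, hC, hbC⟩ := hbearing b hbA hb
    have hbound : ∀ t, 0 ≤ t → ∀ i j, G.Adj i j → ‖b t i j‖ ≤ C + 1 := fun t ht i j hij => by
      have h1 := norm_le_norm_add_norm_sub' (b t i j) (SignedAngle.bearing p i j)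
      rw [SignedAngle.norm_bearing hnet.isISAR.injective hij.ne] at h1
      have h2 : C * Real.exp (-μ * t) ≤ C * 1 := by
        gcongr
        exact Real.exp_le_one_iff.2 (by nlinarith)
      linarith [hbC t ht i j hij]
    obtain ⟨q, hqA, hq, hq0⟩ := SignedAngle.exists_position_solution G p A hbc hbound q₀
    exact ⟨q, b, ⟨hqA, hbA, hq, hb⟩, hq0, hb0⟩
  · obtain ⟨lam, hlam, h⟩ := SignedAngle.exists_position_rate hnet.isISAR hnet.two_le_card hμ
    refine ⟨lam, hlam, fun q b hqb => ?_⟩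
    obtain ⟨C, hC⟩ := h q b hqb.anchor_position hqb.position_ode
      (hbearing b hqb.anchor_bearing hqb.bearing_ode)
    exact ⟨C, fun i _ t ht => hC i t ht⟩
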